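/- **Theorem.** Let $k\ge 1$. There exists a constant $C>0$, depending only on $k$, such that the following holds. Let $S\subset\mathbb{C}^k$ be an affine algebraic curve, i.e. a nonempty common zero set of polynomials all of whose irreducible components have dimension one, and let $S_{\mathrm{sing}}$ be its singular locus. Let $\Omega$ be a simply connected bounded domain in $S$ (a nonempty, connected, relatively open subset of $S$) with $\Omega\cap S_{\mathrm{sing}}=\emptyset$. Let $z_0\in\Omega$, and let $f:\overline{\Omega}\to\mathbb{C}$ be continuous on $\overline\Omega$, holomorphic on $\Omega$, and such that $dd^c\log|f|=\delta_{z_0}$ on $\Omega$ in the sense of distributions, where $dd^c$ is normalized by $dd^c\log|z|=\delta_0$ on $\mathbb{C}$. Then $$\big\|\log|f|\big\|_{L^1(\Omega,\beta)}\ \le\ C\,\max\Big\{\big\|\log|f|\big\|_{L^\infty(\partial\Omega)},\,1\Big\}\,\mathrm{Area}_\beta(\Omega).$$ Here $\beta$ is the standard Hermitian metric on $\mathbb{C}^k$, and $\mathrm{Area}_\beta$ and the $L^1$ norm are taken with respect to the area it induces on $\Omega$ (the two-dimensional Hausdorff measure of the Euclidean distance). The boundary $\partial\Omega$ is taken in $S$,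 and $\|\log|f|\|_{L^\infty(\partial\Omega)}=\sup_{\partial\Omega}\big|\log|f|\big|$, which is $+\infty$ if $f$ vanishes somewhere on $\partial\Omega$. -/

import Mathlib

open MeasureTheory
open scoped ENNReal ContDiff

/-- `S ⊆ ℂ^k` is an affine algebraic curve: the common zero locus of an ideal of polynomials, all of
whose irreducible components have dimension one (`S` may be reducible, but it is nonempty). -/
def IsAffineAlgebraicCurve {k : ℕ} (S : Set (EuclideanSpace ℂ (Fin k))) : Prop :=
  ∃ I : Ideal (MvPolynomial (Fin k) ℂ), I ≠ ⊤ ∧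
    S = {x | x.ofLp ∈ MvPolynomial.zeroLocus ℂ I} ∧
    ∀ p ∈ I.minimalPrimes, ringKrullDim (MvPolynomial (Fin k) ℂ ⧸ p) = 1

/-- `ψ : U → M` is a local holomorphic parametrization of `M ⊆ ℂ^k` by an open set `U ⊆ ℂ`: a
holomorphic immersion which is a homeomorphism of `U` onto a relatively open subset of `M`. Its
inverse is a local holomorphic coordinate on `M`. -/
structure IsLocalParam {k : ℕ} (M : Set (EuclideanSpace ℂ (Fin k))) (U : Set ℂ)
    (ψ : ℂ → EuclideanSpace ℂ (Fin k)) : Prop where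
  isOpen_domain : IsOpen U
  differentiableOn : DifferentiableOn ℂ ψ U
  deriv_ne_zero : ∀ z ∈ U, deriv ψ z ≠ 0
  isEmbedding : Topology.IsEmbedding (U.domRestrict ψ)
  isOpen_image : ∃ V : Set (EuclideanSpace ℂ (Fin k)), IsOpen V ∧ ψ '' U = M ∩ V

/-- The singular locus of `S`: the points near which `S` is not a one-dimensional complex
submanifold of `ℂ^k`. -/
def singularLocus {k : ℕ} (S : Set (EuclideanSpace ℂ (Fin k))) :
    Set (EuclideanSpace ℂ (Fin k)) :=
  {x ∈ S | ¬ ∃ U ψ, IsLocalParam S U ψ ∧ x ∈ ψ '' U}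

/-- `Ω` is a domain of `S` (nonempty, connected and relatively open) contained in the smooth
part of `S`. -/
structure IsSmoothDomain {k : ℕ} (S Ω : Set (EuclideanSpace ℂ (Fin k))) : Prop where
  isOpen_in : ∃ V : Set (EuclideanSpace ℂ (Fin k)), IsOpen V ∧ Ω = S ∩ V
  isConnected : IsConnected Ω
  disjoint_singularLocus : Disjoint Ω (singularLocus S)

/-- `f` is holomorphic on the one-dimensional complex submanifold `Ω`: it is so in every local
holomorphic coordinate. -/
def IsHolomorphicOnCurve {k : ℕ} (f : EuclideanSpace ℂ (Fin k) → ℂ)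
    (Ω : Set (EuclideanSpace ℂ (Fin k))) : Prop :=
  ∀ U ψ, IsLocalParam Ω U ψ → DifferentiableOn ℂ (fun z => f (ψ z)) U

/-- The function `log |f|`, with values in `[-∞, ∞]` and `log 0 = -∞`. -/
noncomputable def logAbs {k : ℕ} (f : EuclideanSpace ℂ (Fin k) → ℂ)
    (x : EuclideanSpace ℂ (Fin k)) : EReal :=
  ENNReal.log ‖f x‖ₑ

/-- The equation `dd^c u = δ_{z₀}` in the sense of distributions on the one-dimensional complex
submanifold `Ω`: in every local holomorphic coordinate `u` is finite almost everywhere and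
locally integrable, and `∫ u dd^c φ = φ(z₀)` for every test function `φ` supported in the
coordinate domain (so the integral is zero if `z₀` is not there). In a coordinate,
`dd^c φ = (2π)⁻¹ Δφ dx dy`, so that `dd^c log |z| = δ₀` on `ℂ`. -/
def DdcEqDirac {k : ℕ} (u : EuclideanSpace ℂ (Fin k) → EReal)
    (Ω : Set (EuclideanSpace ℂ (Fin k))) (z₀ : EuclideanSpace ℂ (Fin k)) : Prop :=
  ∀ U ψ, IsLocalParam Ω U ψ →
    (∀ᵐ z ∂volume.restrict U, u (ψ z) ≠ ⊥ ∧ u (ψ z) ≠ ⊤) ∧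
    LocallyIntegrableOn (fun z => (u (ψ z)).toReal) U ∧
    ∀ φ : ℂ → ℝ, ContDiff ℝ ∞ φ → HasCompactSupport φ → tsupport φ ⊆ U →
      (∀ w ∈ U, ψ w = z₀ →
        ∫ z in U, (u (ψ z)).toReal * ((2 * Real.pi)⁻¹ * Laplacian.laplacian φ z) = φ w) ∧
      (z₀ ∉ ψ '' U →
        ∫ z in U, (u (ψ z)).toReal * ((2 * Real.pi)⁻¹ * Laplacian.laplacian φ z) = 0)

/-- The area measure on (subsets of smooth) complex curves in `ℂ^k` for the standard Hermitian
metric: the two-dimensional Hausdorff measure of the Euclidean distance, normalized so as to agree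
with Lebesgue measure on planes. -/
noncomputable def areaMeasure (k : ℕ) : Measure (EuclideanSpace ℂ (Fin k)) :=
  Measure.euclideanHausdorffMeasure 2

/-- The `L¹` norm of `u` on `Ω` with respect to area, as an element of `[0, ∞]`. -/
noncomputable def normL1 {k : ℕ} (u : EuclideanSpace ℂ (Fin k) → EReal)
    (Ω : Set (EuclideanSpace ℂ (Fin k))) : ℝ≥0∞ :=
  ∫⁻ x in Ω, (u x).abs ∂areaMeasure k

/-- The supremum of `|u|` over `B`, as an element of `[0, ∞]`. -/
noncomputable def normSup {k : ℕ} (u : EuclideanSpace ℂ (Fin k) → EReal)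
    (B : Set (EuclideanSpace ℂ (Fin k))) : ℝ≥0∞ :=
  ⨆ x ∈ B, (u x).abs

/-- The boundary of `Ω` in `S`, for a closed set `S` containing `Ω`. -/
def boundaryIn {k : ℕ} (S Ω : Set (EuclideanSpace ℂ (Fin k))) :
    Set (EuclideanSpace ℂ (Fin k)) :=
  closure Ω ∩ closure (S \ Ω)

open Metric Set Filter Topology

/-! The equation `dd^c log |f| = δ_{z₀}` says that `z₀` is the only zero of `f` and that it is
simple. Let `M` be the maximum of `1` and the boundary sup of `|log |f||`, and `ρ = exp (-M)`. Then
`ρ ≤ |f| ≤ exp M` on the boundary, and the upper bound passes to `Ω` by the maximum principle.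

Since `|f| ≥ ρ` on the boundary, `f` is proper over the disc `|w| < ρ`. Values with exactly one
preimage, at which `f` is regular, form an open and relatively closed subset of that disc
(`isOpen_simpleValues`, `closure_simpleValues_inter_ball_subset`). It contains `0`, so it is the
whole disc, and `f` has a holomorphic injective inverse `Ψ` there.

The area of `Ψ(|w| < r)` is comparable to the integral of `|Ψ'|²`, and `|Ψ'|²` satisfies a sub-mean
value inequality. Hence `Ψ(|w| < tρ)` has area at most `64 t² Area(Ω)` for `t ≤ 1/2`
(`areaMeasure_image_ball_le`). On the shell `|f| ~ ρ 2⁻ⁿ` the function `|log |f||` is at most `M (n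
+ 2)`, while the area is `O(4⁻ⁿ) Area(Ω)`. Summing over `n` and adding the region `|f| ≥ ρ`, where
`|log |f|| ≤ M`, gives the bound with a constant independent even of `k`. -/

/-! ### Polar coordinates and the mean value inequality -/

theorem circleMap_eq_add_polarCoord_symm (c : ℂ) (p : ℝ × ℝ) :
    c + Complex.polarCoord.symm p = circleMap c p.1 p.2 := by
  rw [Complex.polarCoord_symm_apply, circleMap, Complex.exp_mul_I, Complex.ofReal_cos,
    Complex.ofReal_sin]

theorem circleMap_mem_ball_iff {c : ℂ} {r t θ : ℝ} (ht : 0 < t) :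
    circleMap c t θ ∈ ball c r ↔ t < r := by
  simp [mem_ball, dist_eq_norm, circleMap, abs_of_pos ht]

theorem setLIntegral_ball_eq_polar {F : ℂ → ℝ≥0∞} (hF : Measurable F) (c : ℂ) (r : ℝ) :
    ∫⁻ z in ball c r, F z =
      ∫⁻ t in Ioo 0 r, ENNReal.ofReal t * ∫⁻ θ in Ioo (-Real.pi) Real.pi, F (circleMap c t θ) := by
  have hG : Measurable ((ball c r).indicator F) := hF.indicator measurableSet_ball
  rw [← lintegral_indicator measurableSet_ball, ← lintegral_add_left_eq_self _ c,
    ← Complex.lintegral_comp_polarCoord_symm]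
  simp_rw [circleMap_eq_add_polarCoord_symm]
  have hcm : Measurable fun p : ℝ × ℝ => circleMap c p.1 p.2 := by
    unfold circleMap; fun_prop
  have : polarCoord.target = Ioi (0 : ℝ) ×ˢ Ioo (-Real.pi) Real.pi := rfl
  rw [this, Measure.volume_eq_prod, setLIntegral_prod]
  · rw [show Ioo 0 r = Iio r ∩ Ioi 0 by rw [inter_comm]; rfl,
      ← setLIntegral_indicator measurableSet_Iio]
    rw [← lintegral_indicator measurableSet_Ioi, ← lintegral_indicator measurableSet_Ioi]
    congr 1
    ext t
    by_cases ht : t ∈ Ioi (0 : ℝ)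
    · simp only [indicator_of_mem ht]
      by_cases htr : t < r
      · rw [indicator_of_mem (show t ∈ Iio r from htr)]
        simp_rw [indicator_of_mem ((circleMap_mem_ball_iff ht).2 htr), smul_eq_mul]
        rw [lintegral_const_mul]
        exact hF.comp (by unfold circleMap; fun_prop)
      · rw [indicator_of_notMem (show t ∉ Iio r from htr)]
        have : ∀ θ, circleMap c t θ ∉ ball c r := fun θ h => htr ((circleMap_mem_ball_iff ht).1 h)
        simp [indicator_of_notMem (this _)]
    · simp only [indicator_of_notMem ht]
  · exact ((ENNReal.measurable_ofReal.comp measurable_fst).smul (hG.comp hcm)).aemeasurable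

theorem sq_norm_le_circleAverage {E : Type*} [NormedAddCommGroup E] [NormedSpace ℂ E]
    [CompleteSpace E] {h : ℂ → E} {c : ℂ} {R t : ℝ} (hh : DifferentiableOn ℂ h (ball c R))
    (ht : 0 < t) (htR : t < R) :
    ‖h c‖ ^ 2 ≤ Real.circleAverage (fun z => ‖h z‖ ^ 2) c t := by
  have hsub : closedBall c |t| ⊆ ball c R := by
    rw [abs_of_pos ht]; exact closedBall_subset_ball htR
  have hd : DiffContOnCl ℂ h (ball c |t|) := by
    apply DifferentiableOn.diffContOnCl
    exact hh.mono (closure_ball_subset_closedBall.trans hsub)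
  have hc : ContinuousOn h (sphere c |t|) := hh.continuousOn.mono (sphere_subset_closedBall.trans hsub)
  have i1 : CircleIntegrable (fun z => ‖h z‖) c t := by
    apply ContinuousOn.circleIntegrable'
    exact hc.norm
  have i2 : CircleIntegrable (fun z => ‖h z‖ ^ 2) c t := by
    apply ContinuousOn.circleIntegrable'
    exact hc.norm.pow 2
  have hm : ‖h c‖ ≤ Real.circleAverage (fun z => ‖h z‖) c t := by
    rw [← hd.circleAverage, Real.circleAverage_def, Real.circleAverage_def, norm_smul, smul_eq_mul,
      Real.norm_of_nonneg (by positivity)]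
    gcongr
    exact intervalIntegral.norm_integral_le_integral_norm Real.two_pi_pos.le
  have i3 : CircleIntegrable ((2 * ‖h c‖) • (fun z => ‖h z‖)) c t := by
    apply ContinuousOn.circleIntegrable'
    exact hc.norm.const_smul _
  have i4 : CircleIntegrable (fun _ : ℂ => -‖h c‖ ^ 2) c t := circleIntegrable_const _ _ _
  have key : Real.circleAverage ((2 * ‖h c‖) • (fun z => ‖h z‖) + fun _ => -‖h c‖ ^ 2) c t ≤
      Real.circleAverage (fun z => ‖h z‖ ^ 2) c t := by
    refine Real.circleAverage_mono (i3.add i4) i2 fun z _ => ?_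
    simp only [Pi.add_apply, Pi.smul_apply, smul_eq_mul]
    -- With `a = ‖h c‖`, `2 a ‖h z‖ - a² ≤ ‖h z‖²`. Averaging this and using `a ≤` average of `‖h‖`
    -- replaces Jensen's inequality.
    nlinarith [sq_nonneg (‖h z‖ - ‖h c‖)]
  rw [Real.circleAverage_add i3 i4, Real.circleAverage_smul, Real.circleAverage_const] at key
  simp only [smul_eq_mul] at key
  nlinarith [norm_nonneg (h c)]

theorem circleAverage_eq_setIntegral (f : ℂ → ℝ) (c : ℂ) (t : ℝ) :
    Real.circleAverage f c t =
      (2 * Real.pi)⁻¹ * ∫ θ in Ioo (-Real.pi) Real.pi, f (circleMap c t θ) := by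
  rw [Real.circleAverage_eq_integral_add (-Real.pi), smul_eq_mul,
    intervalIntegral.integral_comp_add_right (fun θ => f (circleMap c t θ)),
    intervalIntegral.integral_of_le (by linarith [Real.pi_pos]), integral_Ioc_eq_integral_Ioo]
  congr 4 <;> ring

/-- Integrate the circle inequality over all radii `t < R`. -/
theorem enorm_sq_mul_volume_ball_le {E : Type*} [NormedAddCommGroup E] [NormedSpace ℂ E]
    [CompleteSpace E] {h : ℂ → E} {c : ℂ} {R : ℝ} (hh : DifferentiableOn ℂ h (ball c R)) :
    ‖h c‖ₑ ^ 2 * volume (ball c R) ≤ ∫⁻ z in ball c R, ‖h z‖ₑ ^ 2 := by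
  classical
  -- Nothing is known about `h` off the ball, so it is cut off there to obtain a measurable
  -- function.
  let F : ℂ → ℝ≥0∞ := (ball c R).piecewise (fun z => ‖h z‖ₑ ^ 2) 0
  have hFm : Measurable F := by
    refine ContinuousOn.measurable_piecewise ?_ continuousOn_const measurableSet_ball
    exact ENNReal.continuous_pow 2 |>.comp_continuousOn hh.continuousOn.enorm
  have hFeq : ∀ z ∈ ball c R, F z = ‖h z‖ₑ ^ 2 := fun z hz => piecewise_eq_of_mem _ _ _ hz
  have e1 : ∫⁻ z in ball c R, ‖h z‖ₑ ^ 2 = ∫⁻ z in ball c R, F z :=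
    setLIntegral_congr_fun measurableSet_ball fun z hz => (hFeq z hz).symm
  rw [e1, setLIntegral_ball_eq_polar hFm, ← setLIntegral_const,
    setLIntegral_ball_eq_polar measurable_const]
  refine setLIntegral_mono' measurableSet_Ioo fun t ht => ?_
  refine mul_le_mul_right ?_ _
  have hsub : ∀ θ, circleMap c t θ ∈ ball c R := fun θ => (circleMap_mem_ball_iff ht.1).2 ht.2
  have hF : ∀ θ, F (circleMap c t θ) = ENNReal.ofReal (‖h (circleMap c t θ)‖ ^ 2) := fun θ => by
    rw [hFeq _ (hsub θ), ENNReal.ofReal_pow (norm_nonneg _), ofReal_norm]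
  simp_rw [hF]
  have hcont : Continuous fun θ => ‖h (circleMap c t θ)‖ ^ 2 :=
    (hh.continuousOn.comp_continuous (continuous_circleMap c t) hsub).norm.pow 2
  rw [← ofReal_integral_eq_lintegral_ofReal
    ((hcont.integrableOn_Icc (a := -Real.pi) (b := Real.pi)).mono_set Ioo_subset_Icc_self)
    (ae_of_all _ fun θ => by positivity), setLIntegral_const, ← ofReal_norm,
    ← ENNReal.ofReal_pow (norm_nonneg _), Real.volume_Ioo, ← ENNReal.ofReal_mul (by positivity)]
  apply ENNReal.ofReal_le_ofReal
  have := sq_norm_le_circleAverage hh ht.1 ht.2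
  rw [circleAverage_eq_setIntegral, inv_mul_eq_div, le_div_iff₀ Real.two_pi_pos] at this
  linarith

/-! ### Area of holomorphic images of plane domains -/

theorem LipschitzOnWith.euclideanHausdorffMeasure_image_le {X Y : Type*} [EMetricSpace X]
    [EMetricSpace Y] [MeasurableSpace X] [BorelSpace X] [MeasurableSpace Y] [BorelSpace Y]
    {K : NNReal} {f : X → Y} {s : Set X} (h : LipschitzOnWith K f s) (d : ℕ) :
    μHE[d] (f '' s) ≤ (K : ℝ≥0∞) ^ d * μHE[d] s := by
  have := h.hausdorffMeasure_image_le (d := d) (Nat.cast_nonneg d)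
  rw [ENNReal.rpow_natCast] at this
  simp only [Measure.euclideanHausdorffMeasure_def, Measure.smul_apply, ENNReal.smul_def,
    smul_eq_mul]
  calc _ ≤ _ * ((K : ℝ≥0∞) ^ d * μH[d] s) := mul_le_mul_right this _
    _ = _ := by ring

theorem euclideanHausdorffMeasure_two_complex : (μHE[2] : Measure ℂ) = volume := by
  have := InnerProductSpace.euclideanHausdorffMeasure_eq_volume (V := ℂ)
  rwa [Complex.finrank_real_complex] at this

theorem areaMeasure_image_le {k : ℕ} {K : NNReal} {ψ : ℂ → EuclideanSpace ℂ (Fin k)} {s : Set ℂ}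
    (h : LipschitzOnWith K ψ s) : areaMeasure k (ψ '' s) ≤ (K : ℝ≥0∞) ^ 2 * volume s := by
  have := h.euclideanHausdorffMeasure_image_le 2
  rwa [euclideanHausdorffMeasure_two_complex] at this

theorem volume_le_areaMeasure_image {k : ℕ} {K : NNReal} {ψ : ℂ → EuclideanSpace ℂ (Fin k)}
    {s : Set ℂ} (h : ∀ x ∈ s, ∀ y ∈ s, dist x y ≤ K * dist (ψ x) (ψ y)) :
    volume s ≤ (K : ℝ≥0∞) ^ 2 * areaMeasure k (ψ '' s) := by
  have hinj : InjOn ψ s := fun x hx y hy hxy => by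
    have := h x hx y hy
    rw [hxy, dist_self, mul_zero] at this
    exact dist_le_zero.1 this
  have hl : LipschitzOnWith K (Function.invFunOn ψ s) (ψ '' s) := by
    refine LipschitzOnWith.of_dist_le_mul ?_
    rintro _ ⟨x, hx, rfl⟩ _ ⟨y, hy, rfl⟩
    rw [hinj.leftInvOn_invFunOn hx, hinj.leftInvOn_invFunOn hy]
    exact h x hx y hy
  have := hl.euclideanHausdorffMeasure_image_le 2
  rwa [hinj.leftInvOn_invFunOn.image_image, euclideanHausdorffMeasure_two_complex] at this

theorem areaMeasure_singleton (k : ℕ) (x : EuclideanSpace ℂ (Fin k)) : areaMeasure k {x} = 0 := by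
  have := areaMeasure_image_le (k := k) (K := 0) (ψ := fun _ => x) (s := {0})
    (LipschitzWith.const x).lipschitzOnWith
  simpa using this

/-- Let `L = ‖ψ'(w)‖`. Near `w`, `ψ` shrinks distances by at most the factor `L / 2`, and `‖ψ'‖ < 2
L`. Hence the integral is at most `(2L)² (2/L)² = 16` times the area of the image, a crude area
formula. -/
theorem exists_nhds_lintegral_deriv_le {k : ℕ} {ψ : ℂ → EuclideanSpace ℂ (Fin k)} {w : ℂ}
    (hψ : AnalyticAt ℂ ψ w) (hw : deriv ψ w ≠ 0) :
    ∃ B ∈ 𝓝 w, ∀ A ⊆ B, MeasurableSet A →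
      ∫⁻ z in A, ‖deriv ψ z‖ₑ ^ 2 ≤ 16 * areaMeasure k (ψ '' A) := by
  set L := ‖deriv ψ w‖₊ with hL
  have hL0 : 0 < L := by simpa [hL, pos_iff_ne_zero] using hw
  obtain ⟨s, hs, happ⟩ := hψ.hasStrictDerivAt.hasStrictFDerivAt.approximates_deriv_on_nhds
    (c := L / 2) (Or.inr (by positivity))
  have hev : ∀ᶠ z in 𝓝 w, ‖deriv ψ z‖₊ < 2 * L := by
    have : ContinuousAt (fun z => ‖deriv ψ z‖₊) w := hψ.deriv.continuousAt.nnnorm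
    exact this.eventually_lt continuousAt_const (by rw [two_mul]; exact lt_add_of_pos_left _ hL0)
  refine ⟨s ∩ {z | ‖deriv ψ z‖₊ < 2 * L}, inter_mem hs hev, fun A hA hAm => ?_⟩
  have hvol : volume A ≤ ((2 / L : NNReal) : ℝ≥0∞) ^ 2 * areaMeasure k (ψ '' A) := by
    apply volume_le_areaMeasure_image
    intro x hx y hy
    have h1 := happ x (hA hx).1 y (hA hy).1
    simp only [ContinuousLinearMap.toSpanSingleton_apply] at h1
    have h2 : ‖(x - y) • deriv ψ w‖ = ‖x - y‖ * L := by rw [norm_smul]; rfl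
    have h3 := norm_sub_norm_le ((x - y) • deriv ψ w) (ψ x - ψ y)
    rw [h2] at h3
    rw [norm_sub_rev] at h1
    rw [NNReal.coe_div, NNReal.coe_ofNat] at h1
    have hLr : (0 : ℝ) < L := hL0
    rw [dist_eq_norm, dist_eq_norm, NNReal.coe_div, NNReal.coe_ofNat, div_mul_eq_mul_div,
      le_div_iff₀ hLr]
    linarith
  have hint : ∫⁻ z in A, ‖deriv ψ z‖ₑ ^ 2 ≤ ((2 * L : NNReal) : ℝ≥0∞) ^ 2 * volume A := by
    rw [← setLIntegral_const]
    refine setLIntegral_mono' hAm fun z hz => ?_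
    gcongr
    rw [enorm_eq_nnnorm]
    exact_mod_cast (hA hz).2.le
  refine hint.trans ((mul_le_mul_right hvol _).trans_eq ?_)
  rw [← mul_assoc, ← mul_pow, ← ENNReal.coe_mul]
  have : 2 * L * (2 / L) = 4 := by field_simp; norm_num
  rw [this]
  norm_num

/-- The zeros of `ψ'` contribute nothing. The rest of `D` is cut into countably many disjoint
measurable pieces, each inside a good neighbourhood. By injectivity their images are disjoint, so
the local estimates add up. -/
theorem lintegral_sq_enorm_deriv_le_areaMeasure_image {k : ℕ} {ψ : ℂ → EuclideanSpace ℂ (Fin k)}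
    {D : Set ℂ} (hD : IsOpen D) (hψ : DifferentiableOn ℂ ψ D) (hinj : InjOn ψ D) :
    ∫⁻ z in D, ‖deriv ψ z‖ₑ ^ 2 ≤ 16 * areaMeasure k (ψ '' D) := by
  have han : AnalyticOnNhd ℂ ψ D := hψ.analyticOnNhd hD
  set D' := D ∩ {z | deriv ψ z ≠ 0} with hD'
  have hD'o : IsOpen D' :=
    han.deriv.continuousOn.isOpen_inter_preimage hD isOpen_ne
  have hstep : ∫⁻ z in D, ‖deriv ψ z‖ₑ ^ 2 ≤ ∫⁻ z in D', ‖deriv ψ z‖ₑ ^ 2 := by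
    rw [← lintegral_inter_add_sdiff _ D hD'o.measurableSet,
      inter_eq_self_of_subset_right (show D' ⊆ D from inter_subset_left)]
    have : ∫⁻ z in D \ D', ‖deriv ψ z‖ₑ ^ 2 = 0 := by
      rw [setLIntegral_congr_fun (hD.measurableSet.diff hD'o.measurableSet) (g := fun _ => 0)]
      · simp
      · intro z hz
        have : deriv ψ z = 0 := by
          by_contra h
          exact hz.2 ⟨hz.1, h⟩
        simp [this]
    rw [this, add_zero]
  refine hstep.trans ?_
  rcases D'.eq_empty_or_nonempty with he | hne
  · simp [he]
  have hloc : ∀ w, ∃ B, w ∈ D' → (IsOpen B ∧ w ∈ B ∧ B ⊆ D' ∧ ∀ A ⊆ B, MeasurableSet A →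
      ∫⁻ z in A, ‖deriv ψ z‖ₑ ^ 2 ≤ 16 * areaMeasure k (ψ '' A)) := by
    intro w
    by_cases hw : w ∈ D'
    · obtain ⟨B, hB, hBA⟩ := exists_nhds_lintegral_deriv_le (han w hw.1) hw.2
      obtain ⟨V, hV, hVo, hwV⟩ := _root_.mem_nhds_iff.1 (inter_mem hB (hD'o.mem_nhds hw))
      exact ⟨V, fun _ => ⟨hVo, hwV, fun x hx => (hV hx).2, fun A hA =>
        hBA A fun x hx => (hV (hA hx)).1⟩⟩
    · exact ⟨∅, fun h => absurd h hw⟩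
  choose B hB using hloc
  obtain ⟨t, htD, htc, htcov⟩ := TopologicalSpace.countable_cover_nhdsWithin (f := B) (s := D')
    fun x hx => mem_nhdsWithin_of_mem_nhds ((hB x hx).1.mem_nhds (hB x hx).2.1)
  have htne : t.Nonempty := by
    obtain ⟨x, hx⟩ := hne
    obtain ⟨y, hy, -⟩ := mem_iUnion₂.1 (htcov hx)
    exact ⟨y, hy⟩
  obtain ⟨u, rfl⟩ := htc.exists_eq_range htne
  have hu : ∀ n, u n ∈ D' := fun n => htD (mem_range_self n)
  set A := disjointed fun n => B (u n) with hA
  have hAB : ∀ n, A n ⊆ B (u n) := fun n => disjointed_subset _ n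
  have hAm : ∀ n, MeasurableSet (A n) :=
    MeasurableSet.disjointed fun n => (hB _ (hu n)).1.measurableSet
  have hAD : ∀ n, A n ⊆ D := fun n =>
    (hAB n).trans ((hB _ (hu n)).2.2.1.trans inter_subset_left)
  have hAdisj : Pairwise (Function.onFun Disjoint A) := disjoint_disjointed _
  have hcov : D' ⊆ ⋃ n, A n := by
    rw [hA, iUnion_disjointed]
    rwa [biUnion_range] at htcov
  have himgdisj : Pairwise (Function.onFun Disjoint fun n => ψ '' A n) := fun i j hij =>
    by
    have := hinj.image_inter (hAD i) (hAD j)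
    rw [(hAdisj hij).inter_eq, image_empty] at this
    exact disjoint_iff_inter_eq_empty.2 this.symm
  calc ∫⁻ z in D', ‖deriv ψ z‖ₑ ^ 2 ≤ ∫⁻ z in ⋃ n, A n, ‖deriv ψ z‖ₑ ^ 2 :=
        lintegral_mono_set hcov
    _ = ∑' n, ∫⁻ z in A n, ‖deriv ψ z‖ₑ ^ 2 := lintegral_iUnion hAm hAdisj _
    _ ≤ ∑' n, 16 * areaMeasure k (ψ '' A n) :=
        ENNReal.tsum_le_tsum fun n => (hB _ (hu n)).2.2.2 _ (hAB n) (hAm n)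
    _ = 16 * areaMeasure k (⋃ n, ψ '' A n) := by
        rw [ENNReal.tsum_mul_left, measure_iUnion himgdisj]
        exact fun n => (hAm n).image_of_continuousOn_injOn (hψ.continuousOn.mono (hAD n))
          (hinj.mono (hAD n))
    _ ≤ 16 * areaMeasure k (ψ '' D) := by
        gcongr
        exact iUnion_subset fun n => image_mono (hAD n)

/-- For `|z| < tR ≤ R/2` the disc of radius `R/2` about `z` stays in the large one, so the mean
value inequality for `ψ'` bounds `‖ψ' z‖² π (R/2)²` by `16 T`. Thus `ψ` is Lipschitz on the small
disc with `C² = 64 T / (π R²)`, and the image has area at most `C² π t² R² = 64 t² T`. -/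
theorem areaMeasure_image_ball_le {k : ℕ} {ψ : ℂ → EuclideanSpace ℂ (Fin k)} {R : ℝ}
    (hψ : DifferentiableOn ℂ ψ (ball 0 R)) (hinj : InjOn ψ (ball 0 R))
    (hR : 0 < R) {t : ℝ} (ht : 0 < t) (ht2 : t ≤ 1 / 2) :
    areaMeasure k (ψ '' ball 0 (t * R)) ≤
      ENNReal.ofReal (64 * t ^ 2) * areaMeasure k (ψ '' ball 0 R) := by
  set T := areaMeasure k (ψ '' ball 0 R) with hT
  by_cases hTtop : T = ⊤
  · rw [hTtop, ENNReal.mul_top]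
    · exact le_top
    · simpa using by positivity
  have hballs : ball (0 : ℂ) (t * R) ⊆ ball 0 R := ball_subset_ball (by nlinarith)
  have hder : DifferentiableOn ℂ (deriv ψ) (ball 0 R) := hψ.deriv isOpen_ball
  have hpt : ∀ z ∈ ball (0 : ℂ) (t * R),
      ‖deriv ψ z‖ ^ 2 * (Real.pi * (R / 2) ^ 2) ≤ 16 * T.toReal := by
    intro z hz
    have hsub : ball z (R / 2) ⊆ ball 0 R := by
      intro y hy
      rw [mem_ball, dist_eq_norm] at *
      rw [sub_zero] at *
      have := norm_sub_norm_le y z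
      nlinarith
    have h1 := enorm_sq_mul_volume_ball_le (hder.mono hsub)
    have h2 : ‖deriv ψ z‖ₑ ^ 2 * volume (ball z (R / 2)) ≤ 16 * T :=
      h1.trans ((lintegral_mono_set hsub).trans
        (lintegral_sq_enorm_deriv_le_areaMeasure_image isOpen_ball hψ hinj))
    have h3 := ENNReal.toReal_mono (by finiteness) h2
    have h4 : (0 : ℝ) ≤ R / 2 := by positivity
    simpa [Complex.volume_ball, mul_comm, ENNReal.toReal_ofReal h4] using h3
  set C : ℝ := Real.sqrt (16 * T.toReal / (Real.pi * (R / 2) ^ 2)) with hC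
  have hC0 : 0 ≤ C := Real.sqrt_nonneg _
  have hlip : LipschitzOnWith (NNReal.mk C hC0) ψ (ball 0 (t * R)) := by
    refine Convex.lipschitzOnWith_of_nnnorm_deriv_le (𝕜 := ℂ) (fun z hz => ?_) (fun z hz => ?_)
      (convex_ball _ _)
    · exact hψ.differentiableAt (isOpen_ball.mem_nhds (hballs hz))
    · change ‖deriv ψ z‖ ≤ C
      apply Real.le_sqrt_of_sq_le
      rw [le_div_iff₀ (by positivity)]
      exact hpt z hz
  refine (areaMeasure_image_le hlip).trans ?_
  rw [Complex.volume_ball, ← ENNReal.ofReal_toReal hTtop, ← ENNReal.ofReal_mul (by positivity)]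
  have e1 : ((NNReal.mk C hC0 : NNReal) : ℝ≥0∞) = ENNReal.ofReal C := by
    rw [ENNReal.ofReal, Real.toNNReal_of_nonneg hC0]
  have e2 : ((NNReal.pi : NNReal) : ℝ≥0∞) = ENNReal.ofReal Real.pi := by
    rw [ENNReal.ofReal, Real.toNNReal_of_nonneg Real.pi_pos.le]; rfl
  rw [e1, e2, ← ENNReal.ofReal_pow hC0, ← ENNReal.ofReal_pow (by positivity),
    ← ENNReal.ofReal_mul (by positivity), ← ENNReal.ofReal_mul (by positivity)]
  apply ENNReal.ofReal_le_ofReal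
  rw [hC, Real.sq_sqrt (by positivity)]
  have := Real.pi_pos
  apply le_of_eq
  field_simp
  ring

/-! ### Testing `log |g|` against radial functions -/

theorem setIntegral_ball_eq_polar {F : ℂ → ℝ} (hF : Measurable F) {c : ℂ} {r : ℝ}
    (hFi : IntegrableOn F (ball c r)) :
    ∫ z in ball c r, F z =
      ∫ t in Ioo 0 r, t * ∫ θ in Ioo (-Real.pi) Real.pi, F (circleMap c t θ) := by
  set G := (ball c r).indicator F with hGdef
  have hG : Measurable G := hF.indicator measurableSet_ball
  have hcm : Measurable fun p : ℝ × ℝ => circleMap c p.1 p.2 := by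
    unfold circleMap; fun_prop
  have htar : polarCoord.target = Ioi (0 : ℝ) ×ˢ Ioo (-Real.pi) Real.pi := rfl
  have hGi : ∫⁻ z, ‖G z‖ₑ < ⊤ := by
    have := (integrable_indicator_iff measurableSet_ball).2 hFi
    exact this.2
  have hPi : IntegrableOn (fun p : ℝ × ℝ => p.1 • G (circleMap c p.1 p.2)) polarCoord.target
      (volume.prod volume) := by
    refine ⟨(measurable_fst.smul (hG.comp hcm)).aestronglyMeasurable, ?_⟩
    rw [hasFiniteIntegral_iff_enorm, ← Measure.volume_eq_prod]
    have e : ∫⁻ z, ‖G z‖ₑ =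
        ∫⁻ p in polarCoord.target, ‖p.1 • G (circleMap c p.1 p.2)‖ₑ := by
      rw [← lintegral_add_left_eq_self _ c, ← Complex.lintegral_comp_polarCoord_symm]
      refine setLIntegral_congr_fun polarCoord.open_target.measurableSet fun p hp => ?_
      simp only [circleMap_eq_add_polarCoord_symm]
      rw [enorm_smul, Real.enorm_eq_ofReal (le_of_lt hp.1), smul_eq_mul]
    rwa [← e]
  rw [← integral_indicator measurableSet_ball, ← hGdef, ← integral_add_left_eq_self _ c,
    ← Complex.integral_comp_polarCoord_symm]
  simp_rw [circleMap_eq_add_polarCoord_symm]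
  rw [Measure.volume_eq_prod]
  rw [htar] at hPi ⊢
  rw [setIntegral_prod _ hPi]
  rw [show Ioo 0 r = Ioi 0 ∩ Iio r from rfl, ← setIntegral_indicator measurableSet_Iio]
  refine setIntegral_congr_fun measurableSet_Ioi fun t ht => ?_
  by_cases htr : t < r
  · rw [indicator_of_mem (show t ∈ Iio r from htr)]
    simp_rw [hGdef, indicator_of_mem ((circleMap_mem_ball_iff ht).2 htr), smul_eq_mul]
    rw [integral_const_mul]
  · rw [indicator_of_notMem (show t ∉ Iio r from htr)]
    have : ∀ θ, circleMap c t θ ∉ ball c r := fun θ h => htr ((circleMap_mem_ball_iff ht).1 h)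
    simp [hGdef, indicator_of_notMem (this _)]

theorem laplacian_comp_norm_sub_sq {χ : ℝ → ℝ} (hχ : ContDiff ℝ 2 χ) (c z : ℂ) :
    Laplacian.laplacian (fun w => χ (‖w - c‖ ^ 2)) z =
      4 * deriv χ (‖z - c‖ ^ 2) + 4 * ‖z - c‖ ^ 2 * deriv (deriv χ) (‖z - c‖ ^ 2) := by
  have hχ' : ContDiff ℝ 1 (deriv χ) := (contDiff_succ_iff_deriv (n := 1)).1 hχ |>.2.2
  have hd1 : ∀ s, HasDerivAt χ (deriv χ s) s := fun s =>
    (hχ.differentiable (by norm_num) s).hasDerivAt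
  have hd2 : ∀ s, HasDerivAt (deriv χ) (deriv (deriv χ) s) s := fun s =>
    (hχ'.differentiable (by norm_num) s).hasDerivAt
  have hn : ∀ w : ℂ, HasFDerivAt (fun w : ℂ => ‖w - c‖ ^ 2) (2 • innerSL ℝ (w - c)) w := fun w => by
    simpa using ((hasFDerivAt_id (𝕜 := ℝ) w).sub_const c).norm_sq
  have hf : ∀ w : ℂ, HasFDerivAt (fun w => χ (‖w - c‖ ^ 2))
      (deriv χ (‖w - c‖ ^ 2) • (2 • innerSL ℝ (w - c))) w := fun w =>
    (hd1 _).comp_hasFDerivAt w (hn w)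
  have hfd : fderiv ℝ (fun w => χ (‖w - c‖ ^ 2)) =
      fun w => deriv χ (‖w - c‖ ^ 2) • (2 • innerSL ℝ (w - c)) := funext fun w => (hf w).fderiv
  have hinner : ∀ w : ℂ, HasFDerivAt (fun w : ℂ => 2 • innerSL ℝ (w - c))
      (2 • (innerSL ℝ : ℂ →L[ℝ] ℂ →L[ℝ] ℝ)) w := fun w => by
    have := ((innerSL ℝ : ℂ →L[ℝ] ℂ →L[ℝ] ℝ).hasFDerivAt (x := w - c)).comp w
      ((hasFDerivAt_id (𝕜 := ℝ) w).sub_const c)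
    exact this.const_smul 2
  have h2 := ((hd2 _).comp_hasFDerivAt z (hn z)).smul (hinner z)
  rw [InnerProductSpace.laplacian_eq_iteratedFDeriv_complexPlane]
  simp only [iteratedFDeriv_two_apply, hfd]
  erw [h2.fderiv]
  have hs : ‖z - c‖ ^ 2 = (z.re - c.re) ^ 2 + (z.im - c.im) ^ 2 := by
    rw [← Complex.normSq_eq_norm_sq, Complex.normSq_apply]
    simp; ring
  have i1 : innerSL ℝ (1 : ℂ) 1 = 1 := by rw [innerSL_apply_apply]; simp
  have i2 : innerSL ℝ Complex.I Complex.I = 1 := by rw [innerSL_apply_apply]; simp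
  simp [Complex.inner, i1, i2]
  rw [hs]
  ring

theorem integral_radial_laplacian_mul_log {χ : ℝ → ℝ} (hχ : ContDiff ℝ 2 χ) {R : ℝ} (hR : 0 < R)
    (h0 : χ (R ^ 2) = 0) (h1 : deriv χ (R ^ 2) = 0) (m κ : ℝ) :
    ∫ r in Ioo 0 R, r * ((4 * deriv χ (r ^ 2) + 4 * r ^ 2 * deriv (deriv χ) (r ^ 2)) *
      (m * Real.log r + κ)) = m * χ 0 := by
  have hχ' : ContDiff ℝ 1 (deriv χ) := (contDiff_succ_iff_deriv (n := 1)).1 hχ |>.2.2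
  have hχ'' : Continuous (deriv (deriv χ)) := hχ'.continuous_deriv (by norm_num)
  have hd1 : ∀ s, HasDerivAt χ (deriv χ s) s := fun s =>
    (hχ.differentiable (by norm_num) s).hasDerivAt
  have hd2 : ∀ s, HasDerivAt (deriv χ) (deriv (deriv χ) s) s := fun s =>
    (hχ'.differentiable (by norm_num) s).hasDerivAt
  have hc1 := hχ'.continuous
  have hc0 := hχ.continuous
  -- Green's primitive `r φ' u - r u' φ` for `φ(r) = χ(r²)` and `u = m log r + κ`. Keeping `r log r`
  -- together makes it continuous at `0`, where it equals `-m χ 0`.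
  let H : ℝ → ℝ := fun r =>
    2 * r * deriv χ (r ^ 2) * (m * (r * Real.log r) + κ * r) - m * χ (r ^ 2)
  have hml := Real.continuous_mul_log
  have hH : Continuous H := by fun_prop
  let I : ℝ → ℝ := fun r => (4 * deriv χ (r ^ 2) + 4 * r ^ 2 * deriv (deriv χ) (r ^ 2)) *
      (m * (r * Real.log r) + κ * r)
  have hI : Continuous I := by fun_prop
  have hIeq : ∀ r : ℝ, r * ((4 * deriv χ (r ^ 2) + 4 * r ^ 2 * deriv (deriv χ) (r ^ 2)) *
      (m * Real.log r + κ)) = I r := fun r => by simp only [I]; ring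
  simp_rw [hIeq]
  rw [← integral_Ioc_eq_integral_Ioo, ← intervalIntegral.integral_of_le hR.le,
    intervalIntegral.integral_eq_sub_of_hasDerivAt_of_le hR.le (f := H) hH.continuousOn _
      (hI.intervalIntegrable _ _)]
  · simp only [H, h0, h1]
    simp
  · intro r hr
    have hr0 : r ≠ 0 := hr.1.ne'
    have e2 : HasDerivAt (fun r : ℝ => r ^ 2) (2 * r) r := by simpa using hasDerivAt_pow 2 r
    have a1 := (hd1 (r ^ 2)).comp r e2
    have a2 := (hd2 (r ^ 2)).comp r e2
    have a3 := ((Real.hasDerivAt_mul_log hr0).const_mul m).add ((hasDerivAt_id r).const_mul κ)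
    have a4 := (((hasDerivAt_id r).const_mul 2).mul a2).mul a3 |>.sub (a1.const_mul m)
    refine HasDerivAt.congr_deriv (f := H) a4 ?_
    simp only [I, Function.comp, id, Pi.mul_apply, Pi.add_apply]
    ring

open MeromorphicOn in
-- This is Jensen's formula when the only possible zero is the centre.
theorem circleAverage_log_norm_of_isolated_zero {g : ℂ → ℂ} {c : ℂ} {t : ℝ} {m : ℕ} (ht : 0 < t)
    (hg : AnalyticOnNhd ℂ g (closedBall c t)) (hne : ∀ z ∈ closedBall c t, z ≠ c → g z ≠ 0)
    (hm : analyticOrderAt g c = m) :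
    Real.circleAverage (Real.log ‖g ·‖) c t =
      m * Real.log t + Real.log ‖meromorphicTrailingCoeffAt g c‖ := by
  have habs : |t| = t := abs_of_pos ht
  have h := MeromorphicOn.circleAverage_log_norm (c := c) (R := t) (f := g) ht.ne'
    (by rw [habs]; exact hg.meromorphicOn)
  rw [h, habs]
  -- At `u = c` the factor is `log (t * 0⁻¹) = log 0 = 0` by convention; the zero at the centre is
  -- counted by the separate term `m log t`.
  have hz : ∀ u, (divisor g (closedBall c t) u : ℝ) * Real.log (t * ‖c - u‖⁻¹) = 0 := by
    intro u
    by_cases hu : u = c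
    · simp [hu]
    · by_cases hub : u ∈ closedBall c t
      · rw [hg.divisor_apply hub, (hg u hub).analyticOrderAt_eq_zero.2 (hne u hub hu)]
        simp
      · rw [Function.locallyFinsuppWithin.apply_eq_zero_of_notMem _ hub]
        simp
  simp_rw [hz]
  rw [hg.divisor_apply (mem_closedBall_self ht.le), hm]
  simp

/-- The Laplacian of a radial function is radial, so only the circle averages `m log t + κ` of `log
|g|` matter, and the integral reduces to one over the radius. -/
theorem integral_log_norm_mul_laplacian_radial {g : ℂ → ℂ} {U : Set ℂ} {c : ℂ} {R : ℝ} {m : ℕ}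
    (hR : 0 < R) (hU : MeasurableSet U) (hBU : closedBall c R ⊆ U)
    (hg : AnalyticOnNhd ℂ g (closedBall c R)) (hne : ∀ z ∈ closedBall c R, z ≠ c → g z ≠ 0)
    (hm : analyticOrderAt g c = m)
    (hint : IntegrableOn (fun z => Real.log ‖g z‖) (closedBall c R))
    {χ : ℝ → ℝ} (hχ : ContDiff ℝ 2 χ) (hχ0 : ∀ s, (R / 2) ^ 2 ≤ s → χ s = 0) :
    ∫ z in U, Real.log ‖g z‖ *
      ((2 * Real.pi)⁻¹ * Laplacian.laplacian (fun w => χ (‖w - c‖ ^ 2)) z) = m * χ 0 := by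
  classical
  have hχ' : ContDiff ℝ 1 (deriv χ) := (contDiff_succ_iff_deriv (n := 1)).1 hχ |>.2.2
  have hχ'' : Continuous (deriv (deriv χ)) := hχ'.continuous_deriv (by norm_num)
  have hc1 := hχ'.continuous
  have hlarge : ∀ s, R ^ 2 ≤ s → χ =ᶠ[𝓝 s] fun _ => 0 := fun s hs => by
    filter_upwards [lt_mem_nhds (show (R / 2) ^ 2 < s by nlinarith)] with x hx using hχ0 x hx.le
  have hd1 : ∀ s, R ^ 2 ≤ s → deriv χ s = 0 := fun s hs => by
    rw [(hlarge s hs).deriv_eq]; simp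
  have hd2 : ∀ s, R ^ 2 ≤ s → deriv (deriv χ) s = 0 := fun s hs => by
    rw [(hlarge s hs).deriv.deriv_eq]; simp
  set Λ : ℝ → ℝ := fun r => 4 * deriv χ (r ^ 2) + 4 * r ^ 2 * deriv (deriv χ) (r ^ 2) with hΛ
  have hΛc : Continuous Λ := by fun_prop
  simp_rw [laplacian_comp_norm_sub_sq hχ c]
  let gp : ℂ → ℂ := (ball c R).piecewise g 0
  have hgp : Measurable gp := ContinuousOn.measurable_piecewise
    (hg.continuousOn.mono ball_subset_closedBall) continuousOn_const measurableSet_ball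
  have hgpeq : ∀ z ∈ ball c R, gp z = g z := fun z hz => piecewise_eq_of_mem _ _ _ hz
  let F : ℂ → ℝ := fun z => Real.log ‖gp z‖ * ((2 * Real.pi)⁻¹ * Λ ‖z - c‖)
  have hF : Measurable F :=
    (Real.measurable_log.comp hgp.norm).mul (measurable_const.mul (by fun_prop))
  have hFeq : ∀ z ∈ ball c R, F z = Real.log ‖g z‖ * ((2 * Real.pi)⁻¹ * Λ ‖z - c‖) :=
    fun z hz => by simp only [F, hgpeq z hz]
  have hFi : IntegrableOn F (ball c R) := by
    have : IntegrableOn (fun z => Real.log ‖g z‖ * ((2 * Real.pi)⁻¹ * Λ ‖z - c‖))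
        (closedBall c R) :=
      hint.mul_continuousOn (by fun_prop) (isCompact_closedBall c R)
    exact (this.mono_set ball_subset_closedBall).congr_fun (fun z hz => (hFeq z hz).symm)
      measurableSet_ball
  have e1 : ∫ z in U, Real.log ‖g z‖ * ((2 * Real.pi)⁻¹ * (4 * deriv χ (‖z - c‖ ^ 2) +
      4 * ‖z - c‖ ^ 2 * deriv (deriv χ) (‖z - c‖ ^ 2))) = ∫ z in ball c R, F z := by
    rw [setIntegral_congr_fun measurableSet_ball hFeq]
    refine setIntegral_eq_of_subset_of_forall_sdiff_eq_zero hU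
      (ball_subset_closedBall.trans hBU) fun z hz => ?_
    have hz' : R ≤ ‖z - c‖ := by
      have := hz.2
      rwa [mem_ball, dist_eq_norm, not_lt] at this
    have hz2 : R ^ 2 ≤ ‖z - c‖ ^ 2 := by gcongr
    rw [hd1 _ hz2, hd2 _ hz2]
    simp
  rw [e1, setIntegral_ball_eq_polar hF hFi, ← integral_radial_laplacian_mul_log hχ hR
    (hχ0 _ (by nlinarith)) (hd1 _ le_rfl) m (Real.log ‖meromorphicTrailingCoeffAt g c‖)]
  refine setIntegral_congr_fun measurableSet_Ioo fun t ht => ?_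
  have hb : ∀ θ, circleMap c t θ ∈ ball c R := fun θ => (circleMap_mem_ball_iff ht.1).2 ht.2
  have hn : ∀ θ, ‖circleMap c t θ - c‖ = t := fun θ => by simp [circleMap, abs_of_pos ht.1]
  have hsub : closedBall c t ⊆ closedBall c R := closedBall_subset_closedBall ht.2.le
  have havg := circleAverage_log_norm_of_isolated_zero ht.1 (hg.mono hsub)
    (fun z hz => hne z (hsub hz)) hm
  rw [circleAverage_eq_setIntegral] at havg
  simp only [hFeq _ (hb _), hn]
  rw [integral_mul_const, ← havg]
  simp only [hΛ]
  ring

theorem toReal_log_enorm (w : ℂ) : (ENNReal.log ‖w‖ₑ).toReal = Real.log ‖w‖ := by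
  by_cases hw : w = 0
  · simp [hw]
  · rw [ENNReal.log_pos_real (by simpa using hw) (by simp)]
    simp

/-! ### Local parametrizations and the order of vanishing -/

theorem IsLocalParam.continuousOn {k : ℕ} {M : Set (EuclideanSpace ℂ (Fin k))} {U : Set ℂ}
    {ψ : ℂ → EuclideanSpace ℂ (Fin k)} (h : IsLocalParam M U ψ) : ContinuousOn ψ U :=
  h.differentiableOn.continuousOn

theorem IsLocalParam.map_nhds {k : ℕ} {M : Set (EuclideanSpace ℂ (Fin k))} {U : Set ℂ}
    {ψ : ℂ → EuclideanSpace ℂ (Fin k)} (h : IsLocalParam M U ψ) {c : ℂ} (hc : c ∈ U) :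
    map ψ (𝓝 c) = 𝓝[M] (ψ c) := by
  obtain ⟨V, hV, hVeq⟩ := h.isOpen_image
  have h1 := h.isEmbedding.map_nhds_eq ⟨c, hc⟩
  have h2 : range (U.domRestrict ψ) = M ∩ V := by rw [range_domRestrict, hVeq]
  have hcV : ψ c ∈ V := (hVeq.subset (mem_image_of_mem ψ hc)).2
  rw [h2] at h1
  have h3 : map (U.domRestrict ψ) (𝓝 (⟨c, hc⟩ : U)) = map ψ (𝓝 c) := by
    have : U.domRestrict ψ = ψ ∘ ((↑) : U → ℂ) := rfl
    rw [this, ← Filter.map_map, map_nhds_subtype_coe_eq_nhds hc (h.isOpen_domain.mem_nhds hc)]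
  rw [← h3, h1]
  exact nhdsWithin_inter_of_mem' (mem_nhdsWithin_of_mem_nhds (hV.mem_nhds hcV))

theorem IsLocalParam.injOn {k : ℕ} {M : Set (EuclideanSpace ℂ (Fin k))} {U : Set ℂ}
    {ψ : ℂ → EuclideanSpace ℂ (Fin k)} (h : IsLocalParam M U ψ) : InjOn ψ U :=
  injOn_iff_injective.2 h.isEmbedding.injective

theorem IsLocalParam.mapsTo {k : ℕ} {M : Set (EuclideanSpace ℂ (Fin k))} {U : Set ℂ}
    {ψ : ℂ → EuclideanSpace ℂ (Fin k)} (h : IsLocalParam M U ψ) : MapsTo ψ U M := by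
  obtain ⟨V, -, hVeq⟩ := h.isOpen_image
  exact fun z hz => (hVeq.subset (mem_image_of_mem ψ hz)).1

/-- A local parametrization can be restricted to a smaller domain, and its target to a relatively
open subset containing the image. -/
theorem IsLocalParam.mono {k : ℕ} {M M' : Set (EuclideanSpace ℂ (Fin k))} {U U' : Set ℂ}
    {ψ : ℂ → EuclideanSpace ℂ (Fin k)} (h : IsLocalParam M U ψ) (hU' : IsOpen U') (hUU : U' ⊆ U)
    (hM : M' ⊆ M) (hψM : MapsTo ψ U' M') : IsLocalParam M' U' ψ where
  isOpen_domain := hU'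
  differentiableOn := h.differentiableOn.mono hUU
  deriv_ne_zero z hz := h.deriv_ne_zero z (hUU hz)
  isEmbedding := h.isEmbedding.comp (Topology.IsEmbedding.inclusion hUU)
  isOpen_image := by
    have hex : ∀ x ∈ ψ '' U', ∃ V, IsOpen V ∧ x ∈ V ∧ V ∩ M ⊆ ψ '' U' := by
      rintro _ ⟨z, hz, rfl⟩
      have : ψ '' U' ∈ 𝓝[M] (ψ z) := by
        rw [← h.map_nhds (hUU hz)]
        exact image_mem_map (hU'.mem_nhds hz)
      exact mem_nhdsWithin.1 this
    -- The largest open set whose trace on `M` lies in the image.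
    refine ⟨⋃₀ {V | IsOpen V ∧ V ∩ M ⊆ ψ '' U'}, isOpen_sUnion fun V hV => hV.1, ?_⟩
    ext x
    constructor
    · intro hx
      obtain ⟨V, hV, hxV, hVs⟩ := hex x hx
      obtain ⟨z, hz, rfl⟩ := hx
      exact ⟨hψM hz, V, ⟨hV, hVs⟩, hxV⟩
    · rintro ⟨hxM, V, ⟨-, hVs⟩, hxV⟩
      exact hVs ⟨hxV, hM hxM⟩

/-- Finiteness of `log |g|` almost everywhere excludes `g = 0` near `c`, so `c` has a finite order
`n` and no other zeros nearby. A radial bump function equal to `1` at `c` gives the integral `n`,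
whereas the distributional equation gives `m`. -/
theorem analyticOrderAt_of_ddcEqDirac {k : ℕ} {Ω : Set (EuclideanSpace ℂ (Fin k))}
    {z₀ : EuclideanSpace ℂ (Fin k)} {f : EuclideanSpace ℂ (Fin k) → ℂ}
    (hf : IsHolomorphicOnCurve f Ω) (hdd : DdcEqDirac (logAbs f) Ω z₀) {U : Set ℂ}
    {ψ : ℂ → EuclideanSpace ℂ (Fin k)} (hψ : IsLocalParam Ω U ψ) {c : ℂ} (hc : c ∈ U)
    {m : ℕ} (hm : (ψ c = z₀ ∧ m = 1) ∨ (z₀ ∉ ψ '' U ∧ m = 0)) :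
    analyticOrderAt (fun z => f (ψ z)) c = m := by
  set g : ℂ → ℂ := fun z => f (ψ z) with hg
  have hga : AnalyticOnNhd ℂ g U := (hf U ψ hψ).analyticOnNhd hψ.isOpen_domain
  obtain ⟨hae, hloc, htest⟩ := hdd U ψ hψ
  have hlog : ∀ z, (logAbs f (ψ z)).toReal = Real.log ‖g z‖ := fun z => toReal_log_enorm _
  simp_rw [hlog] at hloc htest
  have hevne : ∀ᶠ z in 𝓝[≠] c, g z ≠ 0 := by
    refine (hga c hc).eventually_eq_zero_or_eventually_ne_zero.resolve_left fun h => ?_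
    rw [ae_restrict_iff' hψ.isOpen_domain.measurableSet] at hae
    have hNB := inter_mem h (hψ.isOpen_domain.mem_nhds hc)
    have hpos : 0 < volume ({x | g x = 0} ∩ U) := Measure.measure_pos_of_mem_nhds volume hNB
    refine hpos.ne' (measure_mono_null ?_ (ae_iff.1 hae))
    rintro z ⟨hz0, hzU⟩ hcon
    refine (hcon hzU).1 ?_
    have : f (ψ z) = 0 := hz0
    simp [logAbs, this]
  have hne_top : analyticOrderAt g c ≠ ⊤ := by
    rw [Ne, analyticOrderAt_eq_top]
    intro h
    obtain ⟨z, hz1, hz2⟩ := ((h.filter_mono nhdsWithin_le_nhds).and hevne).exists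
    exact hz2 hz1
  obtain ⟨n, hn⟩ := ENat.ne_top_iff_exists.1 hne_top
  rw [eventually_nhdsWithin_iff] at hevne
  obtain ⟨R, hR, hRs⟩ := nhds_basis_closedBall.mem_iff.1
    (inter_mem hevne (hψ.isOpen_domain.mem_nhds hc))
  -- As a function of `s = ‖z - c‖²`, the bump is smooth, is `1` at `c`, and vanishes outside radius
  -- `R/2`.
  let χ : ℝ → ℝ := fun s => Real.smoothTransition (1 - s / (R / 2) ^ 2)
  have hχ : ContDiff ℝ ∞ χ := by
    apply Real.smoothTransition.contDiff.comp
    fun_prop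
  have hχ0 : ∀ s, (R / 2) ^ 2 ≤ s → χ s = 0 := fun s hs => by
    apply Real.smoothTransition.zero_of_nonpos
    rw [sub_nonpos, le_div_iff₀ (by positivity)]
    linarith
  have hχ1 : χ 0 = 1 := by simp [χ]
  have hφ : ContDiff ℝ ∞ fun w : ℂ => χ (‖w - c‖ ^ 2) :=
    hχ.comp ((contDiff_norm_sq ℝ).comp (contDiff_id.sub contDiff_const))
  have hts : tsupport (fun w : ℂ => χ (‖w - c‖ ^ 2)) ⊆ closedBall c (R / 2) := by
    apply closure_minimal _ isClosed_closedBall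
    intro w hw
    by_contra hcon
    rw [mem_closedBall, dist_eq_norm, not_le] at hcon
    exact hw (hχ0 _ (by gcongr))
  have hcs : HasCompactSupport fun w : ℂ => χ (‖w - c‖ ^ 2) :=
    (isCompact_closedBall c (R / 2)).of_isClosed_subset (isClosed_tsupport _) hts
  have hballU : closedBall c R ⊆ U := fun z hz => (hRs hz).2
  have hint : IntegrableOn (fun z => Real.log ‖g z‖) (closedBall c R) :=
    hloc.integrableOn_compact_subset hballU (isCompact_closedBall c R)
  have key := integral_log_norm_mul_laplacian_radial hR hψ.isOpen_domain.measurableSet hballU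
    (hga.mono hballU) (fun z hz hzc => (hRs hz).1 hzc) hn.symm hint
    (contDiff_infty.1 hχ 2) hχ0
  obtain ⟨t1, t2⟩ := htest _ hφ hcs
    (hts.trans ((closedBall_subset_closedBall (by linarith)).trans hballU))
  rw [← hn]
  rcases hm with ⟨hcz, rfl⟩ | ⟨hcz, rfl⟩
  · have := t1 c hc hcz
    rw [key] at this
    simp only [sub_self, norm_zero, hχ1] at this
    norm_num [hχ1] at this
    exact_mod_cast this
  · have := t2 hcz
    rw [key, hχ1, mul_one] at this
    exact_mod_cast this

/-! ### Identity theorem, open mapping and maximum principle on the curve -/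

theorem IsLocalParam.eventually_nhdsWithin_iff {k : ℕ} {M : Set (EuclideanSpace ℂ (Fin k))}
    {U : Set ℂ} {ψ : ℂ → EuclideanSpace ℂ (Fin k)} (h : IsLocalParam M U ψ) {c : ℂ} (hc : c ∈ U)
    {p : EuclideanSpace ℂ (Fin k) → Prop} :
    (∀ᶠ y in 𝓝[M] (ψ c), p y) ↔ ∀ᶠ z in 𝓝 c, p (ψ z) := by
  rw [← h.map_nhds hc, eventually_map]

theorem IsLocalParam.tendsto_invFunOn {k : ℕ} {M : Set (EuclideanSpace ℂ (Fin k))}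
    {U : Set ℂ} {ψ : ℂ → EuclideanSpace ℂ (Fin k)} (h : IsLocalParam M U ψ) {c : ℂ} (hc : c ∈ U) :
    Tendsto (Function.invFunOn ψ U) (𝓝[M] (ψ c)) (𝓝 c) := by
  rw [← h.map_nhds hc, tendsto_map'_iff]
  refine tendsto_id.congr' ?_
  filter_upwards [h.isOpen_domain.mem_nhds hc] with z hz
  exact (h.injOn.leftInvOn_invFunOn hz).symm

theorem IsLocalParam.eventually_invFunOn {k : ℕ} {M : Set (EuclideanSpace ℂ (Fin k))}
    {U : Set ℂ} {ψ : ℂ → EuclideanSpace ℂ (Fin k)} (h : IsLocalParam M U ψ) {c : ℂ} (hc : c ∈ U) :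
    ∀ᶠ y in 𝓝[M] (ψ c), ψ (Function.invFunOn ψ U y) = y := by
  rw [h.eventually_nhdsWithin_iff hc]
  filter_upwards [h.isOpen_domain.mem_nhds hc] with z hz
  rw [h.injOn.leftInvOn_invFunOn hz]

/-- A function holomorphic on a connected curve is not locally constant anywhere, if it is not
locally constant at one point. -/
theorem IsHolomorphicOnCurve.not_eventually_eq {k : ℕ} {Ω : Set (EuclideanSpace ℂ (Fin k))}
    {f : EuclideanSpace ℂ (Fin k) → ℂ} (hf : IsHolomorphicOnCurve f Ω) (hconn : IsPreconnected Ω)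
    (hpar : ∀ x ∈ Ω, ∃ U ψ, IsLocalParam Ω U ψ ∧ x ∈ ψ '' U) {z₀ : EuclideanSpace ℂ (Fin k)}
    (hz₀ : z₀ ∈ Ω) (h₀ : ¬ ∀ᶠ y in 𝓝[Ω] z₀, f y = f z₀) {x : EuclideanSpace ℂ (Fin k)}
    (hx : x ∈ Ω) : ¬ ∀ᶠ y in 𝓝[Ω] x, f y = f x := by
  intro hcon
  set a := f x with ha
  -- By the dichotomy for analytic functions, near each point of `Ω` either `f = a`, or `f ≠ a` off
  -- that point; these cases put it in `u` or in `v`. Both are open and no point of `Ω` lies in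
  -- both, so connectedness applies.
  set u := {y | ∀ᶠ z in 𝓝 y, z ∈ Ω → f z = a} with hu
  set v := {y | ∀ᶠ z in 𝓝 y, z ∈ Ω → z ∉ u} with hv
  have huo : IsOpen u := isOpen_setOfPred_eventually_nhds
  have hvo : IsOpen v := isOpen_setOfPred_eventually_nhds
  have hself : ∀ y ∈ Ω, y ∈ u → f y = a := fun y hy hyu => Eventually.self_of_nhds hyu hy
  have hz₀u : z₀ ∉ u := fun h => h₀ (by
    rw [hself z₀ hz₀ h]
    exact _root_.eventually_nhdsWithin_iff.2 h)
  have hcover : Ω ⊆ u ∪ v := by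
    intro y hy
    obtain ⟨U, ψ, hψ, c, hc, rfl⟩ := hpar y hy
    have hga : AnalyticAt ℂ (fun z => f (ψ z)) c :=
      (hf U ψ hψ).analyticAt (hψ.isOpen_domain.mem_nhds hc)
    rcases hga.eventually_eq_or_eventually_ne (analyticAt_const (v := a)) with h | h
    · left
      exact _root_.eventually_nhdsWithin_iff.1 ((hψ.eventually_nhdsWithin_iff hc).2 h)
    · right
      refine _root_.eventually_nhdsWithin_iff.1 ((hψ.eventually_nhdsWithin_iff hc).2 ?_)
      rw [_root_.eventually_nhdsWithin_iff] at h
      filter_upwards [h, hψ.isOpen_domain.mem_nhds hc] with z hz hzU hzu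
      by_cases hzc : z = c
      · subst hzc
        have h1 := (hψ.eventually_nhdsWithin_iff hc).1 (_root_.eventually_nhdsWithin_iff.2 hzu)
        obtain ⟨w, hw1, hw2⟩ :=
          ((h1.filter_mono nhdsWithin_le_nhds).and (_root_.eventually_nhdsWithin_iff.2 h)).exists
        exact hw2 hw1
      · exact hz hzc (hself _ (hψ.mapsTo hzU) hzu)
  have hxu : x ∈ u := _root_.eventually_nhdsWithin_iff.1 hcon
  obtain ⟨y, hy, hyu, hyv⟩ := hconn u v huo hvo hcover ⟨x, hx, hxu⟩
    ⟨z₀, hz₀, (hcover hz₀).resolve_left hz₀u⟩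
  exact Eventually.self_of_nhds hyv hy hyu

theorem IsHolomorphicOnCurve.nhds_le_map {k : ℕ} {Ω : Set (EuclideanSpace ℂ (Fin k))}
    {f : EuclideanSpace ℂ (Fin k) → ℂ} (hf : IsHolomorphicOnCurve f Ω)
    (hpar : ∀ x ∈ Ω, ∃ U ψ, IsLocalParam Ω U ψ ∧ x ∈ ψ '' U) {x : EuclideanSpace ℂ (Fin k)}
    (hx : x ∈ Ω) (hne : ¬ ∀ᶠ y in 𝓝[Ω] x, f y = f x) : 𝓝 (f x) ≤ map f (𝓝[Ω] x) := by
  obtain ⟨U, ψ, hψ, c, hc, rfl⟩ := hpar x hx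
  have hga : AnalyticAt ℂ (fun z => f (ψ z)) c :=
    (hf U ψ hψ).analyticAt (hψ.isOpen_domain.mem_nhds hc)
  rw [hψ.eventually_nhdsWithin_iff hc] at hne
  have := hga.eventually_constant_or_nhds_le_map_nhds.resolve_left hne
  rwa [← hψ.map_nhds hc, Filter.map_map]

/-- If `‖f‖` were maximal at `y` in `Ω`, openness would make the closed disc of radius `‖f y‖` a
neighbourhood of `f y`, a point of its boundary circle. -/
theorem norm_le_of_forall_boundary_le {X : Type*} [TopologicalSpace X] {Ω : Set X} {f : X → ℂ}
    (hcomp : IsCompact (closure Ω)) (hfc : ContinuousOn f (closure Ω))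
    (hopen : ∀ x ∈ Ω, 𝓝 (f x) ≤ map f (𝓝[Ω] x)) {B : ℝ}
    (hB : ∀ x ∈ closure Ω, x ∉ Ω → ‖f x‖ ≤ B) {x : X} (hx : x ∈ Ω) : ‖f x‖ ≤ B := by
  obtain ⟨y, hy, hmax⟩ := hcomp.exists_isMaxOn ⟨x, subset_closure hx⟩ hfc.norm
  refine (hmax (subset_closure hx)).trans ?_
  by_contra hcon
  have hyΩ : y ∈ Ω := by
    by_contra h
    exact hcon (hB y hy h)
  have hmem : closedBall (0 : ℂ) ‖f y‖ ∈ 𝓝 (f y) := by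
    refine hopen y hyΩ ?_
    rw [mem_map]
    filter_upwards [self_mem_nhdsWithin] with z hz
    rw [mem_preimage, mem_closedBall_zero_iff]
    exact hmax (subset_closure hz)
  rw [← mem_interior_iff_mem_nhds, interior_closedBall'] at hmem
  simp at hmem

/-! ### The inverse of `f` over the disc of radius `ρ` -/

/-- This is properness over the disc. For `|a| < r < ρ`, the part of `{|f| ≤ r}` outside `V` is
compact, so its image is closed; it misses `a`, hence all nearby values. -/
theorem eventually_fiber_subset {X : Type*} [TopologicalSpace X] {Ω : Set X} {f : X → ℂ} {ρ : ℝ}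
    (hcomp : IsCompact (closure Ω)) (hfc : ContinuousOn f (closure Ω))
    (hbd : ∀ x ∈ closure Ω, x ∉ Ω → ρ ≤ ‖f x‖) {a : ℂ} (ha : a ∈ ball (0 : ℂ) ρ) {V : Set X}
    (hV : IsOpen V) (hfib : ∀ x ∈ Ω, f x = a → x ∈ V) :
    ∀ᶠ w in 𝓝 a, ∀ x ∈ Ω, f x = w → x ∈ V := by
  rw [mem_ball_zero_iff] at ha
  obtain ⟨r, har, hrρ⟩ := exists_between ha
  have hK : IsCompact ((closure Ω ∩ f ⁻¹' closedBall 0 r) \ V) :=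
    (hcomp.of_isClosed_subset (hfc.preimage_isClosed_of_isClosed isClosed_closure
      isClosed_closedBall) inter_subset_left).diff hV
  have hcl : IsClosed (f '' ((closure Ω ∩ f ⁻¹' closedBall 0 r) \ V)) :=
    (hK.image_of_continuousOn (hfc.mono fun x hx => hx.1.1)).isClosed
  have hna : a ∉ f '' ((closure Ω ∩ f ⁻¹' closedBall 0 r) \ V) := by
    rintro ⟨x, ⟨⟨hx, -⟩, hxV⟩, rfl⟩
    by_cases hxΩ : x ∈ Ω
    · exact hxV (hfib x hxΩ rfl)
    · exact (hbd x hx hxΩ).not_gt ha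
  filter_upwards [hcl.isOpen_compl.mem_nhds hna, continuous_norm.continuousAt.eventually_lt
    continuousAt_const har] with w hw hwr x hx hxw
  by_contra hxV
  refine hw ⟨x, ⟨⟨subset_closure hx, ?_⟩, hxV⟩, hxw⟩
  rw [mem_preimage, hxw, mem_closedBall_zero_iff]
  exact hwr.le

theorem tendsto_invFunOn_of_unique {X : Type*} [TopologicalSpace X] [Nonempty X] {Ω : Set X}
    {f : X → ℂ} {ρ : ℝ} (hcomp : IsCompact (closure Ω)) (hfc : ContinuousOn f (closure Ω))
    (hbd : ∀ x ∈ closure Ω, x ∉ Ω → ρ ≤ ‖f x‖) (hopen : ∀ x ∈ Ω, 𝓝 (f x) ≤ map f (𝓝[Ω] x))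
    {x : X} (hx : x ∈ Ω) (hxρ : f x ∈ ball (0 : ℂ) ρ) (huniq : ∀ y ∈ Ω, f y = f x → y = x) :
    Tendsto (Function.invFunOn f Ω) (𝓝 (f x)) (𝓝[Ω] x) := by
  have himg : f '' Ω ∈ 𝓝 (f x) := hopen x hx (image_mem_map self_mem_nhdsWithin)
  rw [tendsto_nhdsWithin_iff]
  refine ⟨?_, ?_⟩
  · rw [_root_.tendsto_nhds]
    intro V hV hxV
    filter_upwards [himg, eventually_fiber_subset hcomp hfc hbd hxρ hV
      fun y hy hyx => huniq y hy hyx ▸ hxV] with w hw hwV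
    exact hwV _ (Function.invFunOn_mem hw) (Function.invFunOn_eq hw)
  · filter_upwards [himg] with w hw using Function.invFunOn_mem hw

theorem isPreconnected_ball_sdiff_center (a : ℂ) (ε : ℝ) : IsPreconnected (ball a ε \ {a}) := by
  have : ball a ε \ {a} = (fun p : ℝ × ℝ => circleMap a p.1 p.2) '' (Ioo 0 ε ×ˢ univ) := by
    ext z
    constructor
    · rintro ⟨hz, hza⟩
      refine ⟨(‖z - a‖, Complex.arg (z - a)), ⟨⟨?_, ?_⟩, mem_univ _⟩, ?_⟩
      · exact norm_pos_iff.2 (sub_ne_zero.2 hza)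
      · rwa [mem_ball, dist_eq_norm] at hz
      · simp [circleMap]
    · rintro ⟨⟨t, θ⟩, ⟨ht, -⟩, rfl⟩
      refine ⟨(circleMap_mem_ball_iff ht.1).2 ht.2, fun h => ?_⟩
      exact ht.1.ne' (by simpa using h)
  rw [this]
  refine (isPreconnected_Ioo.prod isPreconnected_univ).image _ (Continuous.continuousOn ?_)
  unfold circleMap
  fun_prop

theorem AnalyticAt.eventually_deriv_ne_zero {g : ℂ → ℂ} {c : ℂ} (hg : AnalyticAt ℂ g c)
    (hne : ¬ ∀ᶠ z in 𝓝 c, g z = g c) : ∀ᶠ z in 𝓝[≠] c, deriv g z ≠ 0 := by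
  refine hg.deriv.eventually_eq_zero_or_eventually_ne_zero.resolve_left fun h => hne ?_
  obtain ⟨ε, hε, hs⟩ := Metric.mem_nhds_iff.1 (h.and hg.eventually_analyticAt)
  filter_upwards [ball_mem_nhds c hε] with z hz
  refine isOpen_ball.is_const_of_deriv_eq_zero (isPreconnected_ball (x := c) (r := ε))
    (fun w hw => (hs hw).2.differentiableAt.differentiableWithinAt) (fun w hw => (hs hw).1) hz
    (mem_ball_self hε)

/-- `f` has nonzero derivative at `x` in some local holomorphic coordinate of the curve `Ω`. -/
def IsRegularPoint {k : ℕ} (f : EuclideanSpace ℂ (Fin k) → ℂ)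
    (Ω : Set (EuclideanSpace ℂ (Fin k))) (x : EuclideanSpace ℂ (Fin k)) : Prop :=
  ∃ U ψ, IsLocalParam Ω U ψ ∧ ∃ c ∈ U, ψ c = x ∧ deriv (fun z => f (ψ z)) c ≠ 0

/-- The points of the disc of radius `ρ` having exactly one preimage in `Ω`, which is a regular
point. -/
def simpleValues {k : ℕ} (f : EuclideanSpace ℂ (Fin k) → ℂ)
    (Ω : Set (EuclideanSpace ℂ (Fin k))) (ρ : ℝ) : Set ℂ :=
  {a | a ∈ ball (0 : ℂ) ρ ∧ ∃ x ∈ Ω, f x = a ∧ (∀ y ∈ Ω, f y = a → y = x) ∧ IsRegularPoint f Ω x}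

section

variable {k : ℕ} {Ω : Set (EuclideanSpace ℂ (Fin k))} {f : EuclideanSpace ℂ (Fin k) → ℂ} {ρ : ℝ}

/-- The inverse of `f`, read in the coordinate `ψ`, is a continuous local right inverse of `f ∘ ψ`;
differentiability then follows wherever the derivative is nonzero. -/
theorem local_inverse_of_unique (hcomp : IsCompact (closure Ω)) (hfc : ContinuousOn f (closure Ω))
    (hbd : ∀ x ∈ closure Ω, x ∉ Ω → ρ ≤ ‖f x‖) (hopen : ∀ x ∈ Ω, 𝓝 (f x) ≤ map f (𝓝[Ω] x))
    {U : Set ℂ} {ψ : ℂ → EuclideanSpace ℂ (Fin k)} (hψ : IsLocalParam Ω U ψ) {c : ℂ} (hc : c ∈ U)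
    (hρ : f (ψ c) ∈ ball (0 : ℂ) ρ) (huniq : ∀ y ∈ Ω, f y = f (ψ c) → y = ψ c) :
    ContinuousAt (fun w => Function.invFunOn ψ U (Function.invFunOn f Ω w)) (f (ψ c)) ∧
      Function.invFunOn ψ U (Function.invFunOn f Ω (f (ψ c))) = c ∧
      (∀ᶠ w in 𝓝 (f (ψ c)),
        ψ (Function.invFunOn ψ U (Function.invFunOn f Ω w)) = Function.invFunOn f Ω w) ∧
      ∀ᶠ w in 𝓝 (f (ψ c)), f (ψ (Function.invFunOn ψ U (Function.invFunOn f Ω w))) = w := by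
  have hx := hψ.mapsTo hc
  have ht := tendsto_invFunOn_of_unique hcomp hfc hbd hopen hx hρ huniq
  have himg : f '' Ω ∈ 𝓝 (f (ψ c)) := hopen _ hx (image_mem_map self_mem_nhdsWithin)
  have hval : Function.invFunOn f Ω (f (ψ c)) = ψ c :=
    huniq _ (Function.invFunOn_mem ⟨_, hx, rfl⟩) (Function.invFunOn_eq ⟨_, hx, rfl⟩)
  have hval2 : Function.invFunOn ψ U (Function.invFunOn f Ω (f (ψ c))) = c := by
    rw [hval, hψ.injOn.leftInvOn_invFunOn hc]
  have hev := ht.eventually (hψ.eventually_invFunOn hc)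
  refine ⟨?_, hval2, hev, ?_⟩
  · have := (hψ.tendsto_invFunOn hc).comp ht
    rw [ContinuousAt, hval2]
    exact this
  · filter_upwards [hev, himg] with w hw hwi
    rw [hw]
    exact Function.invFunOn_eq hwi

theorem differentiableAt_invFunOn (hcomp : IsCompact (closure Ω))
    (hfc : ContinuousOn f (closure Ω)) (hbd : ∀ x ∈ closure Ω, x ∉ Ω → ρ ≤ ‖f x‖)
    (hopen : ∀ x ∈ Ω, 𝓝 (f x) ≤ map f (𝓝[Ω] x)) (hf : IsHolomorphicOnCurve f Ω) {a : ℂ}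
    (ha : a ∈ simpleValues f Ω ρ) : DifferentiableAt ℂ (Function.invFunOn f Ω) a := by
  obtain ⟨haρ, x, hx, rfl, huniq, U, ψ, hψ, c, hc, rfl, hreg⟩ := ha
  obtain ⟨h1, h2, h3, h4⟩ := local_inverse_of_unique hcomp hfc hbd hopen hψ hc haρ huniq
  have hg : DifferentiableAt ℂ (fun z => f (ψ z)) c :=
    (hf U ψ hψ).differentiableAt (hψ.isOpen_domain.mem_nhds hc)
  have hζ := HasDerivAt.of_local_left_inverse (f := fun z => f (ψ z)) h1
    (by rw [h2]; exact hg.hasDerivAt) hreg h4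
  have hψd : DifferentiableAt ℂ ψ
      (Function.invFunOn ψ U (Function.invFunOn f Ω (f (ψ c)))) := by
    rw [h2]
    exact hψ.differentiableOn.differentiableAt (hψ.isOpen_domain.mem_nhds hc)
  refine (DifferentiableAt.comp (g := ψ)
    (f := fun w => Function.invFunOn ψ U (Function.invFunOn f Ω w)) (f (ψ c)) hψd
    hζ.differentiableAt).congr_of_eventuallyEq ?_
  filter_upwards [h3] with w hw using hw.symm

/-- Near a regular point `f` is injective and stays regular. By properness all preimages of nearby
values lie in that neighbourhood, so there is just one. -/
theorem isOpen_simpleValues (hcomp : IsCompact (closure Ω))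
    (hfc : ContinuousOn f (closure Ω)) (hbd : ∀ x ∈ closure Ω, x ∉ Ω → ρ ≤ ‖f x‖)
    (hopen : ∀ x ∈ Ω, 𝓝 (f x) ≤ map f (𝓝[Ω] x)) (hf : IsHolomorphicOnCurve f Ω) :
    IsOpen (simpleValues f Ω ρ) := by
  rw [isOpen_iff_mem_nhds]
  rintro a ⟨haρ, x, hx, rfl, huniq, U, ψ, hψ, c, hc, rfl, hreg⟩
  have hga : AnalyticAt ℂ (fun z => f (ψ z)) c :=
    (hf U ψ hψ).analyticAt (hψ.isOpen_domain.mem_nhds hc)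
  have himg : f '' Ω ∈ 𝓝 (f (ψ c)) := hopen _ hx (image_mem_map self_mem_nhdsWithin)
  have hinj : ∃ N ∈ 𝓝 c, InjOn (fun z => f (ψ z)) N := by
    have hl := hga.hasStrictDerivAt.hasStrictFDerivAt_equiv hreg |>.eventually_left_inverse
    refine ⟨_, hl, fun z hz w hw hzw => ?_⟩
    rw [← hz, ← hw]
    exact congrArg _ hzw
  obtain ⟨N, hN, hNinj⟩ := hinj
  have hN' : U ∩ (N ∩ {z | deriv (fun z => f (ψ z)) z ≠ 0}) ∈ 𝓝 c :=
    inter_mem (hψ.isOpen_domain.mem_nhds hc)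
      (inter_mem hN (hga.deriv.continuousAt.eventually_ne hreg))
  have himgN : ψ '' (U ∩ (N ∩ {z | deriv (fun z => f (ψ z)) z ≠ 0})) ∈ 𝓝[Ω] (ψ c) := by
    rw [← hψ.map_nhds hc]
    exact image_mem_map hN'
  obtain ⟨V, hV, hcV, hVs⟩ := mem_nhdsWithin.1 himgN
  filter_upwards [isOpen_ball.mem_nhds haρ, himg, eventually_fiber_subset hcomp hfc hbd haρ hV
    fun y hy hyc => huniq y hy hyc ▸ hcV] with w hwρ hwi hwV
  obtain ⟨y, hy, rfl⟩ := hwi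
  obtain ⟨z, ⟨hzU, hzN, hz⟩, rfl⟩ := hVs ⟨hwV y hy rfl, hy⟩
  refine ⟨hwρ, ψ z, hy, rfl, fun y' hy' hyz => ?_, U, ψ, hψ, z, hzU, rfl, hz⟩
  obtain ⟨z', ⟨-, hzN', -⟩, rfl⟩ := hVs ⟨hwV y' hy' hyz, hy'⟩
  rw [hNinj hzN' hzN hyz]

theorem isOpen_multipleValues {X : Type*} [TopologicalSpace X] [T2Space X] {Ω : Set X} {f : X → ℂ}
    (hopen : ∀ x ∈ Ω, 𝓝 (f x) ≤ map f (𝓝[Ω] x)) :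
    IsOpen {a | ∃ x ∈ Ω, ∃ y ∈ Ω, x ≠ y ∧ f x = a ∧ f y = a} := by
  rw [isOpen_iff_mem_nhds]
  rintro a ⟨x, hx, y, hy, hxy, hxa, rfl⟩
  obtain ⟨V, W, hV, hW, hxV, hyW, hdisj⟩ := t2_separation hxy
  have h1 : f '' (Ω ∩ V) ∈ 𝓝 (f x) :=
    hopen x hx (image_mem_map (inter_mem_nhdsWithin _ (hV.mem_nhds hxV)))
  have h2 : f '' (Ω ∩ W) ∈ 𝓝 (f y) :=
    hopen y hy (image_mem_map (inter_mem_nhdsWithin _ (hW.mem_nhds hyW)))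
  rw [hxa] at h1
  filter_upwards [h1, h2]
  rintro w ⟨p, ⟨hp, hpV⟩, rfl⟩ ⟨q, ⟨hq, hqW⟩, hqp⟩
  exact ⟨p, hp, q, hq, fun h => disjoint_left.1 hdisj hpV (h ▸ hqW), rfl, hqp⟩

/-- A limit `a` of simple values has a preimage by properness, and only one because multiple values
form an open set. It is regular because, around `a`, all values other than `a` are simple, so the
inverse is holomorphic off `a` and continuous at `a`. The singularity is removable, and
differentiating `f ∘ f⁻¹ = id` excludes a critical point. -/
theorem closure_simpleValues_inter_ball_subset (hcomp : IsCompact (closure Ω))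
    (hfc : ContinuousOn f (closure Ω)) (hbd : ∀ x ∈ closure Ω, x ∉ Ω → ρ ≤ ‖f x‖)
    (hopen : ∀ x ∈ Ω, 𝓝 (f x) ≤ map f (𝓝[Ω] x)) (hf : IsHolomorphicOnCurve f Ω)
    (hpar : ∀ x ∈ Ω, ∃ U ψ, IsLocalParam Ω U ψ ∧ x ∈ ψ '' U)
    (hne : ∀ x ∈ Ω, ¬ ∀ᶠ y in 𝓝[Ω] x, f y = f x) :
    closure (simpleValues f Ω ρ) ∩ ball 0 ρ ⊆ simpleValues f Ω ρ := by
  rintro a ⟨hacl, haρ⟩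
  by_contra hanot
  have hA := isOpen_simpleValues hcomp hfc hbd hopen hf
  have hM := isOpen_multipleValues hopen
  have hdisj : ∀ w, w ∈ simpleValues f Ω ρ →
      w ∉ {a | ∃ x ∈ Ω, ∃ y ∈ Ω, x ≠ y ∧ f x = a ∧ f y = a} := by
    rintro w ⟨-, x, -, -, huniq, -⟩ ⟨p, hp, q, hq, hpq, hpw, hqw⟩
    exact hpq ((huniq p hp hpw).trans (huniq q hq hqw).symm)
  have hex : ∃ x ∈ Ω, f x = a := by
    by_contra hcon
    push Not at hcon
    obtain ⟨w, hwV, -, x, hx, hxw, -⟩ := mem_closure_iff_nhds.1 hacl _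
      (eventually_fiber_subset hcomp hfc hbd haρ isOpen_empty fun x hx hxa => (hcon x hx hxa))
    exact hwV x hx hxw
  obtain ⟨x, hx, rfl⟩ := hex
  have huniq : ∀ y ∈ Ω, f y = f x → y = x := by
    intro y hy hyx
    by_contra hyne
    obtain ⟨w, hwM, hwA⟩ := mem_closure_iff_nhds.1 hacl _
      (hM.mem_nhds ⟨y, hy, x, hx, hyne, hyx, rfl⟩)
    exact hdisj w hwA hwM
  obtain ⟨U, ψ, hψ, c, hc, rfl⟩ := hpar x hx
  have hga : AnalyticAt ℂ (fun z => f (ψ z)) c :=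
    (hf U ψ hψ).analyticAt (hψ.isOpen_domain.mem_nhds hc)
  have hder := hga.eventually_deriv_ne_zero (by
    rw [← hψ.eventually_nhdsWithin_iff (p := fun y => f y = f (ψ c)) hc]
    exact hne _ hx)
  rw [_root_.eventually_nhdsWithin_iff] at hder
  have himgN : ψ '' (U ∩ {z | z ∈ ({c}ᶜ : Set ℂ) → deriv (fun z => f (ψ z)) z ≠ 0}) ∈
      𝓝[Ω] (ψ c) := by
    rw [← hψ.map_nhds hc]
    exact image_mem_map (inter_mem (hψ.isOpen_domain.mem_nhds hc) hder)
  obtain ⟨V, hV, hcV, hVs⟩ := mem_nhdsWithin.1 himgN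
  have himg : f '' Ω ∈ 𝓝 (f (ψ c)) := hopen _ hx (image_mem_map self_mem_nhdsWithin)
  have hnear : ∀ᶠ w in 𝓝 (f (ψ c)), w ≠ f (ψ c) → w ∈ simpleValues f Ω ρ ∪
      {a | ∃ x ∈ Ω, ∃ y ∈ Ω, x ≠ y ∧ f x = a ∧ f y = a} := by
    filter_upwards [isOpen_ball.mem_nhds haρ, himg, eventually_fiber_subset hcomp hfc hbd haρ hV
      fun y hy hyc => huniq y hy hyc ▸ hcV] with w hwρ hwi hwV hwne
    obtain ⟨y, hy, rfl⟩ := hwi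
    by_cases hm : ∃ q ∈ Ω, f q = f y ∧ q ≠ y
    · obtain ⟨q, hq, hqy, hne⟩ := hm
      exact Or.inr ⟨q, hq, y, hy, hne, hqy, rfl⟩
    · push Not at hm
      obtain ⟨z, ⟨hzU, hz⟩, rfl⟩ := hVs ⟨hwV y hy rfl, hy⟩
      refine Or.inl ⟨hwρ, ψ z, hy, rfl, hm, U, ψ, hψ, z, hzU, rfl, hz ?_⟩
      rintro rfl
      exact hwne rfl
  obtain ⟨ε, hε, hεs⟩ := Metric.mem_nhds_iff.1 hnear
  -- The connected punctured disc is covered by two disjoint open sets, the simple and the multiple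
  -- values, and it meets the first.
  have hpunct : ball (f (ψ c)) ε \ {f (ψ c)} ⊆ simpleValues f Ω ρ := by
    have hcov : ball (f (ψ c)) ε \ {f (ψ c)} ⊆ simpleValues f Ω ρ ∪
      {a | ∃ x ∈ Ω, ∃ y ∈ Ω, x ≠ y ∧ f x = a ∧ f y = a} := fun w hw => hεs hw.1 hw.2
    obtain ⟨w, hwb, hwA⟩ := mem_closure_iff_nhds.1 hacl _ (ball_mem_nhds (f (ψ c)) hε)
    have hwne : w ≠ f (ψ c) := fun h => hanot (h ▸ hwA)
    intro v hv
    refine (hcov hv).resolve_right fun hvM => ?_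
    obtain ⟨p, -, hp1, hp2⟩ := isPreconnected_ball_sdiff_center _ _ _ _ hA hM hcov
      ⟨w, ⟨hwb, hwne⟩, hwA⟩ ⟨v, hv, hvM⟩
    exact hdisj p hp1 hp2
  obtain ⟨h1, h2, h3, h4⟩ := local_inverse_of_unique hcomp hfc hbd hopen hψ hc haρ huniq
  set ζ : ℂ → ℂ := fun w => Function.invFunOn ψ U (Function.invFunOn f Ω w) with hζ
  have hζa : ζ (f (ψ c)) = c := h2
  have hζd : ∀ᶠ w in 𝓝[≠] (f (ψ c)), DifferentiableAt ℂ ζ w := by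
    rw [_root_.eventually_nhdsWithin_iff]
    have hUev : ∀ᶠ w in 𝓝 (f (ψ c)), ζ w ∈ U :=
      h1.eventually_mem (by rw [hζa]; exact hψ.isOpen_domain.mem_nhds hc)
    have hdev : ∀ᶠ w in 𝓝 (f (ψ c)), ζ w ∈ ({c}ᶜ : Set ℂ) →
        deriv (fun z => f (ψ z)) (ζ w) ≠ 0 := by
      have h1' : Tendsto ζ (𝓝 (f (ψ c))) (𝓝 c) := by
        rw [ContinuousAt, hζa] at h1
        exact h1
      exact h1'.eventually hder
    filter_upwards [hUev, hdev, h3.eventually_nhds, h4.eventually_nhds, ball_mem_nhds _ hε]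
      with w hwU hwd hw3 hw4 hwb hwne
    have hwA := hpunct ⟨hwb, hwne⟩
    obtain ⟨hwρ, y, hy, rfl, hyuniq, -⟩ := hwA
    have hyψ : ψ (ζ (f y)) = y := hyuniq _ (hψ.mapsTo hwU) hw4.self_of_nhds
    have hyuniq' : ∀ y' ∈ Ω, f y' = f (ψ (ζ (f y))) → y' = ψ (ζ (f y)) := by
      rw [hyψ]; exact hyuniq
    obtain ⟨g1, g2, -, -⟩ := local_inverse_of_unique hcomp hfc hbd hopen hψ hwU
      (by rw [hyψ]; exact hwρ) hyuniq'
    rw [hyψ] at g1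
    have hne' : ζ (f y) ≠ c := by
      intro h
      rw [h] at hyψ
      exact hwne (by rw [← hyψ]; rfl)
    have hgd : DifferentiableAt ℂ (fun z => f (ψ z)) (ζ (f y)) :=
      (hf U ψ hψ).differentiableAt (hψ.isOpen_domain.mem_nhds hwU)
    exact (HasDerivAt.of_local_left_inverse (f := fun z => f (ψ z)) g1 hgd.hasDerivAt
      (hwd hne') hw4).differentiableAt
  have hζan := Complex.analyticAt_of_differentiable_on_punctured_nhds_of_continuousAt hζd h1
  refine hanot ⟨haρ, ψ c, hx, rfl, huniq, U, ψ, hψ, c, hc, rfl, fun h0 => ?_⟩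
  have hgζ : HasDerivAt (fun z => f (ψ z)) 0 (ζ (f (ψ c))) := by
    rw [hζa, ← h0]
    exact hga.differentiableAt.hasDerivAt
  have hcompd := hgζ.comp (f (ψ c)) hζan.differentiableAt.hasDerivAt
  have hid : HasDerivAt (fun w : ℂ => w) (0 * deriv ζ (f (ψ c))) (f (ψ c)) :=
    hcompd.congr_of_eventuallyEq (by filter_upwards [h4] with w hw using hw.symm)
  have := hid.unique (hasDerivAt_id _)
  simp at this

theorem ball_subset_simpleValues (hcomp : IsCompact (closure Ω))
    (hfc : ContinuousOn f (closure Ω)) (hbd : ∀ x ∈ closure Ω, x ∉ Ω → ρ ≤ ‖f x‖)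
    (hopen : ∀ x ∈ Ω, 𝓝 (f x) ≤ map f (𝓝[Ω] x)) (hf : IsHolomorphicOnCurve f Ω)
    (hpar : ∀ x ∈ Ω, ∃ U ψ, IsLocalParam Ω U ψ ∧ x ∈ ψ '' U)
    (hne : ∀ x ∈ Ω, ¬ ∀ᶠ y in 𝓝[Ω] x, f y = f x) (h0 : 0 ∈ simpleValues f Ω ρ) :
    ball 0 ρ ⊆ simpleValues f Ω ρ :=
  isPreconnected_ball.subset_of_closure_inter_subset
    (isOpen_simpleValues hcomp hfc hbd hopen hf) ⟨0, h0.1, h0⟩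
    (closure_simpleValues_inter_ball_subset hcomp hfc hbd hopen hf hpar hne)

end

/-! ### Closedness of the curve and boundary values of `|f|` -/

theorem IsAffineAlgebraicCurve.isClosed {k : ℕ} {S : Set (EuclideanSpace ℂ (Fin k))}
    (hS : IsAffineAlgebraicCurve S) : IsClosed S := by
  obtain ⟨I, -, rfl, -⟩ := hS
  have : {x : EuclideanSpace ℂ (Fin k) | x.ofLp ∈ MvPolynomial.zeroLocus ℂ I} =
      ⋂ p ∈ I, {x | MvPolynomial.eval x.ofLp p = 0} := by
    ext x
    simp [MvPolynomial.mem_zeroLocus_iff, MvPolynomial.aeval_eq_eval]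
  rw [this]
  exact isClosed_biInter fun p _ => isClosed_eq
    ((MvPolynomial.continuous_eval p).comp (PiLp.continuous_ofLp 2 _)) continuous_const

theorem IsSmoothDomain.exists_isLocalParam {k : ℕ} {S Ω : Set (EuclideanSpace ℂ (Fin k))}
    (hΩ : IsSmoothDomain S Ω) {x : EuclideanSpace ℂ (Fin k)} (hx : x ∈ Ω) :
    ∃ U ψ, IsLocalParam Ω U ψ ∧ x ∈ ψ '' U := by
  obtain ⟨V, hV, hΩV⟩ := hΩ.isOpen_in
  have hxV : x ∈ S ∩ V := hΩV ▸ hx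
  have hns : x ∉ singularLocus S := disjoint_left.1 hΩ.disjoint_singularLocus hx
  have : ∃ U ψ, IsLocalParam S U ψ ∧ x ∈ ψ '' U := by
    by_contra h
    exact hns ⟨hxV.1, h⟩
  obtain ⟨U, ψ, hψ, z, hz, rfl⟩ := this
  refine ⟨U ∩ ψ ⁻¹' V, ψ, hψ.mono ?_ inter_subset_left ?_ ?_, z, ⟨hz, hxV.2⟩, rfl⟩
  · exact hψ.continuousOn.isOpen_inter_preimage hψ.isOpen_domain hV
  · exact hΩV ▸ inter_subset_left
  · intro w hw
    rw [hΩV]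
    exact ⟨hψ.mapsTo hw.1, hw.2⟩

theorem mem_boundaryIn {k : ℕ} {S Ω : Set (EuclideanSpace ℂ (Fin k))} (hS : IsClosed S)
    (hΩS : Ω ⊆ S) {x : EuclideanSpace ℂ (Fin k)} (hx : x ∈ closure Ω) (hxΩ : x ∉ Ω) :
    x ∈ boundaryIn S Ω :=
  ⟨hx, subset_closure ⟨closure_minimal hΩS hS hx, hxΩ⟩⟩

theorem abs_logAbs_of_ne_zero {k : ℕ} {f : EuclideanSpace ℂ (Fin k) → ℂ}
    {x : EuclideanSpace ℂ (Fin k)} (hx : f x ≠ 0) :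
    (logAbs f x).abs = ENNReal.ofReal |Real.log ‖f x‖| := by
  rw [logAbs, ENNReal.log_pos_real (by simpa using hx) (by simp), EReal.abs_def]
  simp

theorem abs_logAbs_of_eq_zero {k : ℕ} {f : EuclideanSpace ℂ (Fin k) → ℂ}
    {x : EuclideanSpace ℂ (Fin k)} (hx : f x = 0) : (logAbs f x).abs = ⊤ := by
  simp [logAbs, hx]

theorem norm_mem_Icc_of_abs_logAbs_le {k : ℕ} {f : EuclideanSpace ℂ (Fin k) → ℂ}
    {x : EuclideanSpace ℂ (Fin k)} {M : ℝ} (hM : 0 ≤ M)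
    (h : (logAbs f x).abs ≤ ENNReal.ofReal M) : ‖f x‖ ∈ Icc (Real.exp (-M)) (Real.exp M) := by
  have hx : f x ≠ 0 := fun h0 => by
    rw [abs_logAbs_of_eq_zero h0] at h
    exact ENNReal.ofReal_ne_top (top_le_iff.1 h)
  rw [abs_logAbs_of_ne_zero hx, ENNReal.ofReal_le_ofReal_iff hM, abs_le] at h
  have hpos := norm_pos_iff.2 hx
  exact ⟨(Real.le_log_iff_exp_le hpos).1 h.1, (Real.log_le_iff_le_exp hpos).1 h.2⟩

theorem AnalyticAt.deriv_ne_zero_of_analyticOrderAt_eq_one {g : ℂ → ℂ} {c : ℂ}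
    (hg : AnalyticAt ℂ g c) (h : analyticOrderAt g c = 1) : deriv g c ≠ 0 := by
  obtain ⟨u, hu, hu0, hgu⟩ := (hg.analyticOrderAt_eq_natCast (n := 1)).1 (by exact_mod_cast h)
  have hd : HasDerivAt (fun z => (z - c) ^ 1 • u z) (u c) c := by
    have := ((hasDerivAt_id c).sub_const c).mul hu.differentiableAt.hasDerivAt
    simp only [id, sub_self, zero_mul, add_zero, one_mul] at this
    exact this.congr_of_eventuallyEq (Eventually.of_forall fun z => by simp)
  rw [(hd.congr_of_eventuallyEq hgu).deriv]
  exact hu0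

/-! ### Zeros of `f`, decay of sublevel areas and the `L¹` estimate -/

section

variable {k : ℕ} {Ω : Set (EuclideanSpace ℂ (Fin k))} {f : EuclideanSpace ℂ (Fin k) → ℂ}
  {z₀ : EuclideanSpace ℂ (Fin k)}

theorem apply_ne_zero_of_ddcEqDirac (hf : IsHolomorphicOnCurve f Ω)
    (hdd : DdcEqDirac (logAbs f) Ω z₀) (hpar : ∀ x ∈ Ω, ∃ U ψ, IsLocalParam Ω U ψ ∧ x ∈ ψ '' U)
    {x : EuclideanSpace ℂ (Fin k)} (hx : x ∈ Ω) (hxz : x ≠ z₀) : f x ≠ 0 := by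
  obtain ⟨U, ψ, hψ, c, hc, rfl⟩ := hpar x hx
  -- Removing `z₀` from the coordinate domain makes the distributional equation homogeneous, so the
  -- order at `c` is `0`.
  have hψ' : IsLocalParam Ω (U ∩ ψ ⁻¹' {z₀}ᶜ) ψ :=
    hψ.mono (hψ.continuousOn.isOpen_inter_preimage hψ.isOpen_domain isOpen_compl_singleton)
      inter_subset_left Subset.rfl (hψ.mapsTo.mono_left inter_subset_left)
  have hc' : c ∈ U ∩ ψ ⁻¹' {z₀}ᶜ := ⟨hc, hxz⟩
  have h0 := analyticOrderAt_of_ddcEqDirac hf hdd hψ' hc' (m := 0)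
    (Or.inr ⟨fun ⟨w, hw, hwz⟩ => hw.2 hwz, rfl⟩)
  have hga : AnalyticAt ℂ (fun z => f (ψ z)) c :=
    (hf _ ψ hψ').analyticAt (hψ'.isOpen_domain.mem_nhds hc')
  exact hga.analyticOrderAt_eq_zero.1 (by exact_mod_cast h0)

theorem isRegularPoint_of_ddcEqDirac (hf : IsHolomorphicOnCurve f Ω)
    (hdd : DdcEqDirac (logAbs f) Ω z₀) (hpar : ∀ x ∈ Ω, ∃ U ψ, IsLocalParam Ω U ψ ∧ x ∈ ψ '' U)
    (hz₀ : z₀ ∈ Ω) :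
    f z₀ = 0 ∧ IsRegularPoint f Ω z₀ ∧ ¬ ∀ᶠ y in 𝓝[Ω] z₀, f y = f z₀ := by
  obtain ⟨U, ψ, hψ, c, hc, rfl⟩ := hpar z₀ hz₀
  have h1 := analyticOrderAt_of_ddcEqDirac hf hdd hψ hc (m := 1) (Or.inl ⟨rfl, rfl⟩)
  have h1' : analyticOrderAt (fun z => f (ψ z)) c = 1 := by exact_mod_cast h1
  have hga : AnalyticAt ℂ (fun z => f (ψ z)) c :=
    (hf _ ψ hψ).analyticAt (hψ.isOpen_domain.mem_nhds hc)
  have h0 : f (ψ c) = 0 := by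
    by_contra h
    rw [hga.analyticOrderAt_eq_zero.2 h] at h1'
    exact zero_ne_one h1'
  refine ⟨h0, ⟨U, ψ, hψ, c, hc, rfl, hga.deriv_ne_zero_of_analyticOrderAt_eq_one h1'⟩, fun h => ?_⟩
  rw [hψ.eventually_nhdsWithin_iff hc, h0] at h
  rw [analyticOrderAt_eq_top.2 h] at h1'
  exact ENat.top_ne_one h1'

/-- If `f` maps the part of `Ω` where `|f| < ρ` bijectively onto the disc of radius `ρ`, with
holomorphic inverse, the area of `{|f| < ρ 2⁻ⁿ}` decays like `4⁻ⁿ`. -/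
theorem areaMeasure_sublevel_le {ρ : ℝ} (hρ : 0 < ρ)
    (hdiff : DifferentiableOn ℂ (Function.invFunOn f Ω) (ball 0 ρ))
    (hsv : ball 0 ρ ⊆ simpleValues f Ω ρ) (n : ℕ) :
    areaMeasure k {x ∈ Ω | ‖f x‖ < ρ * (1 / 2) ^ n} ≤
      ENNReal.ofReal (64 * (1 / 4) ^ n) * areaMeasure k Ω := by
  set Ψ := Function.invFunOn f Ω with hΨ
  have hmem : ∀ w ∈ ball (0 : ℂ) ρ, Ψ w ∈ Ω ∧ f (Ψ w) = w := fun w hw => by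
    obtain ⟨-, x, hx, hxw, -⟩ := hsv hw
    exact ⟨Function.invFunOn_mem ⟨x, hx, hxw⟩, Function.invFunOn_eq ⟨x, hx, hxw⟩⟩
  have hinj : InjOn Ψ (ball 0 ρ) := fun w hw v hv hwv => by
    rw [← (hmem w hw).2, ← (hmem v hv).2, hwv]
  have himg : Ψ '' ball 0 ρ ⊆ Ω := by
    rintro _ ⟨w, hw, rfl⟩
    exact (hmem w hw).1
  rcases Nat.eq_zero_or_pos n with rfl | hn
  -- The area estimate needs `t ≤ 1/2`; for `n = 0` the trivial bound suffices because `64 ≥ 1`.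
  · calc areaMeasure k {x ∈ Ω | ‖f x‖ < ρ * (1 / 2) ^ 0} ≤ 1 * areaMeasure k Ω := by
          rw [one_mul]; exact measure_mono fun x hx => hx.1
      _ ≤ _ := by
          gcongr
          rw [← ENNReal.ofReal_one]
          exact ENNReal.ofReal_le_ofReal (by norm_num)
  · have ht : ((1 : ℝ) / 2) ^ n ≤ 1 / 2 := by
      calc ((1 : ℝ) / 2) ^ n ≤ (1 / 2) ^ 1 :=
            pow_le_pow_of_le_one (by norm_num) (by norm_num) hn
        _ = 1 / 2 := pow_one _
    have hsub : {x ∈ Ω | ‖f x‖ < ρ * (1 / 2) ^ n} ⊆ Ψ '' ball 0 ((1 / 2) ^ n * ρ) := by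
      rintro x ⟨hx, hxn⟩
      have hxn' : ‖f x‖ < (1 / 2) ^ n * ρ := by rwa [mul_comm]
      have hxρ : f x ∈ ball (0 : ℂ) ρ := by
        rw [mem_ball_zero_iff]
        nlinarith
      refine ⟨f x, mem_ball_zero_iff.2 hxn', ?_⟩
      obtain ⟨-, y, -, -, huniq, -⟩ := hsv hxρ
      exact (huniq _ (hmem _ hxρ).1 (hmem _ hxρ).2).trans (huniq x hx rfl).symm
    calc areaMeasure k {x ∈ Ω | ‖f x‖ < ρ * (1 / 2) ^ n}
        ≤ areaMeasure k (Ψ '' ball 0 ((1 / 2) ^ n * ρ)) := measure_mono hsub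
      _ ≤ ENNReal.ofReal (64 * ((1 / 2) ^ n) ^ 2) * areaMeasure k (Ψ '' ball 0 ρ) :=
          areaMeasure_image_ball_le hdiff hinj hρ (by positivity) ht
      _ ≤ ENNReal.ofReal (64 * (1 / 4) ^ n) * areaMeasure k Ω := by
          rw [← pow_mul, mul_comm n 2, pow_mul]
          norm_num only
          gcongr

/-- The region `|f| ≥ ρ` contributes `M`, and the point `z₀` is null. The dyadic shell `A n`
contributes at most `2 M 2ⁿ · 64 · 4⁻ⁿ = 128 M 2⁻ⁿ`. The total is `1 + 256 = 257` times `M Area(Ω)`.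
-/
theorem normL1_logAbs_le {M : ℝ} (hM : 1 ≤ M) (hz₀ : ∀ x ∈ Ω, f x = 0 → x = z₀)
    (hup : ∀ x ∈ Ω, ‖f x‖ ≤ Real.exp M)
    (hdecay : ∀ n : ℕ, areaMeasure k {x ∈ Ω | ‖f x‖ < Real.exp (-M) * (1 / 2) ^ n} ≤
      ENNReal.ofReal (64 * (1 / 4) ^ n) * areaMeasure k Ω) :
    normL1 (logAbs f) Ω ≤ ENNReal.ofReal 257 * ENNReal.ofReal M * areaMeasure k Ω := by
  set ρ := Real.exp (-M) with hρ
  have hρ0 : 0 < ρ := Real.exp_pos _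
  have hlogρ : Real.log ρ = -M := Real.log_exp _
  set A : ℕ → Set (EuclideanSpace ℂ (Fin k)) :=
    fun n => {x ∈ Ω | ρ * (1 / 2) ^ (n + 1) ≤ ‖f x‖ ∧ ‖f x‖ < ρ * (1 / 2) ^ n} with hA
  have hcover : Ω ⊆ ({x ∈ Ω | ρ ≤ ‖f x‖} ∪ {z₀}) ∪ ⋃ n, A n := by
    intro x hx
    by_cases h1 : ρ ≤ ‖f x‖
    · exact Or.inl (Or.inl ⟨hx, h1⟩)
    by_cases h2 : f x = 0
    · exact Or.inl (Or.inr (hz₀ x hx h2))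
    right
    push Not at h1
    have hpos : 0 < ‖f x‖ / ρ := div_pos (norm_pos_iff.2 h2) hρ0
    obtain ⟨N, hN⟩ := exists_pow_lt_of_lt_one hpos (show (1 / 2 : ℝ) < 1 by norm_num)
    have hex : ∃ n : ℕ, ρ * (1 / 2) ^ n ≤ ‖f x‖ :=
      ⟨N, by rw [lt_div_iff₀ hρ0] at hN; linarith⟩
    classical
    obtain ⟨n, hn⟩ := Nat.exists_eq_succ_of_ne_zero (n := Nat.find hex) fun h => by
      have := Nat.find_spec hex
      rw [h] at this
      simp only [pow_zero, mul_one] at this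
      exact this.not_gt h1
    refine mem_iUnion.2 ⟨n, hx, ?_, ?_⟩
    · have := Nat.find_spec hex
      rwa [hn] at this
    · exact not_le.1 (Nat.find_min hex (by rw [hn]; exact n.lt_succ_self))
  have hB : ∫⁻ x in {x ∈ Ω | ρ ≤ ‖f x‖}, (logAbs f x).abs ∂areaMeasure k ≤
      ENNReal.ofReal M * areaMeasure k Ω := by
    calc _ ≤ ∫⁻ _ in {x ∈ Ω | ρ ≤ ‖f x‖}, ENNReal.ofReal M ∂areaMeasure k := by
          refine setLIntegral_mono measurable_const fun x hx => ?_
          have hpos : 0 < ‖f x‖ := hρ0.trans_le hx.2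
          rw [abs_logAbs_of_ne_zero (norm_pos_iff.1 hpos)]
          refine ENNReal.ofReal_le_ofReal (abs_le.2 ⟨?_, ?_⟩)
          · exact (Real.le_log_iff_exp_le hpos).2 hx.2
          · exact (Real.log_le_iff_le_exp hpos).2 (hup x hx.1)
      _ ≤ _ := by
          rw [setLIntegral_const]
          gcongr
          exact fun x hx => hx.1
  have hAn : ∀ n, ∫⁻ x in A n, (logAbs f x).abs ∂areaMeasure k ≤
      ENNReal.ofReal (128 * M * (1 / 2) ^ n) * areaMeasure k Ω := by
    intro n
    -- On `A n`, `|log |f|| ≤ M + (n + 1) log 2 ≤ M (n + 2)` since `M ≥ 1`; bounding `n + 2` by `2 *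
    -- 2 ^ n` turns the sum into a geometric series.
    have h2n : (n : ℝ) + 2 ≤ 2 * 2 ^ n := by
      have : n + 1 ≤ 2 ^ n := Nat.lt_two_pow_self
      have h' : (n : ℝ) + 1 ≤ 2 ^ n := by exact_mod_cast this
      have h'' : (1 : ℝ) ≤ 2 ^ n := one_le_pow₀ (by norm_num)
      linarith
    calc _ ≤ ∫⁻ _ in A n, ENNReal.ofReal (M * (2 * 2 ^ n)) ∂areaMeasure k := by
          refine setLIntegral_mono measurable_const fun x hx => ?_
          obtain ⟨hxΩ, hx1, hx2⟩ := hx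
          have hpos : 0 < ‖f x‖ := lt_of_lt_of_le (by positivity) hx1
          rw [abs_logAbs_of_ne_zero (norm_pos_iff.1 hpos)]
          refine ENNReal.ofReal_le_ofReal (abs_le.2 ⟨?_, ?_⟩)
          · have := Real.log_le_log (by positivity) hx1
            rw [Real.log_mul hρ0.ne' (by positivity), Real.log_pow, hlogρ, one_div,
              Real.log_inv] at this
            push_cast at this
            have hl2 : Real.log 2 ≤ 1 := by linarith [Real.log_two_lt_d9]
            have hn0 : (0 : ℝ) ≤ n := n.cast_nonneg
            nlinarith
          · have hle : ‖f x‖ ≤ Real.exp M := hup x hxΩ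
            have := (Real.log_le_iff_le_exp hpos).2 hle
            have h'' : (1 : ℝ) ≤ 2 ^ n := one_le_pow₀ (by norm_num)
            nlinarith
      _ ≤ ENNReal.ofReal (M * (2 * 2 ^ n)) * (ENNReal.ofReal (64 * (1 / 4) ^ n) *
            areaMeasure k Ω) := by
          rw [setLIntegral_const]
          gcongr
          have hsub : A n ⊆ {x ∈ Ω | ‖f x‖ < ρ * (1 / 2) ^ n} := fun x hx => ⟨hx.1, hx.2.2⟩
          exact (measure_mono hsub).trans (hdecay n)
      _ = _ := by
          rw [← mul_assoc, ← ENNReal.ofReal_mul (by positivity)]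
          congr 2
          rw [show ((1 : ℝ) / 4) ^ n = (1 / 2) ^ n * (1 / 2) ^ n by rw [← mul_pow]; norm_num]
          have : (2 : ℝ) ^ n * (1 / 2) ^ n = 1 := by rw [← mul_pow]; norm_num
          linear_combination 128 * M * (1 / 2) ^ n * this
  calc normL1 (logAbs f) Ω
      ≤ ∫⁻ x in ({x ∈ Ω | ρ ≤ ‖f x‖} ∪ {z₀}) ∪ ⋃ n, A n, (logAbs f x).abs ∂areaMeasure k :=
        lintegral_mono_set hcover
    _ ≤ (∫⁻ x in {x ∈ Ω | ρ ≤ ‖f x‖}, (logAbs f x).abs ∂areaMeasure k +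
          ∫⁻ x in {z₀}, (logAbs f x).abs ∂areaMeasure k) +
          ∑' n, ∫⁻ x in A n, (logAbs f x).abs ∂areaMeasure k :=
        (lintegral_union_le _ _ _).trans
          (add_le_add (lintegral_union_le _ _ _) (lintegral_iUnion_le _ _))
    _ ≤ (ENNReal.ofReal M * areaMeasure k Ω + 0) +
          ∑' n : ℕ, ENNReal.ofReal (128 * M * (1 / 2) ^ n) * areaMeasure k Ω := by
        gcongr
        · rw [setLIntegral_measure_zero _ _ (areaMeasure_singleton k z₀)]
        · exact hAn _
    _ = ENNReal.ofReal 257 * ENNReal.ofReal M * areaMeasure k Ω := by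
        rw [ENNReal.tsum_mul_right, ← ENNReal.ofReal_tsum_of_nonneg (fun n => by positivity)
          (summable_geometric_two.mul_left _), tsum_mul_left, tsum_geometric_two, add_zero,
          ← add_mul, ← ENNReal.ofReal_add (by positivity) (by positivity),
          ← ENNReal.ofReal_mul (by norm_num)]
        congr 2
        ring

end

theorem mainTheorem7 (k : ℕ) (hk : 1 ≤ k) :
    ∃ C : ℝ, 0 < C ∧
      ∀ S : Set (EuclideanSpace ℂ (Fin k)), IsAffineAlgebraicCurve S →
      ∀ Ω : Set (EuclideanSpace ℂ (Fin k)), IsSmoothDomain S Ω → IsSimplyConnected Ω →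
        Bornology.IsBounded Ω →
      ∀ z₀ ∈ Ω, ∀ f : EuclideanSpace ℂ (Fin k) → ℂ, ContinuousOn f (closure Ω) →
        IsHolomorphicOnCurve f Ω → DdcEqDirac (logAbs f) Ω z₀ →
        normL1 (logAbs f) Ω ≤
          ENNReal.ofReal C * max (normSup (logAbs f) (boundaryIn S Ω)) 1 * areaMeasure k Ω := by
  refine ⟨257, by norm_num, fun S hS Ω hΩ _ hbdd z₀ hz₀ f hfc hf hdd => ?_⟩
  set m := max (normSup (logAbs f) (boundaryIn S Ω)) 1 with hm
  -- If the boundary norm is infinite, the right side is `∞` unless the area is `0`, and then the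
  -- left side is `0` as well.
  by_cases hmtop : m = ⊤
  · by_cases hA : areaMeasure k Ω = 0
    · rw [normL1, setLIntegral_measure_zero _ _ hA]
      exact zero_le
    · rw [hmtop, ENNReal.mul_top (by simp), ENNReal.top_mul hA]
      exact le_top
  set M := m.toReal with hM
  have hmM : ENNReal.ofReal M = m := ENNReal.ofReal_toReal hmtop
  have hM1 : 1 ≤ M := by
    rw [hM, ← ENNReal.toReal_one]
    exact ENNReal.toReal_mono hmtop (le_max_right _ _)
  have hpar : ∀ x ∈ Ω, ∃ U ψ, IsLocalParam Ω U ψ ∧ x ∈ ψ '' U :=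
    fun x hx => hΩ.exists_isLocalParam hx
  have hΩS : Ω ⊆ S := by
    obtain ⟨V, -, hV⟩ := hΩ.isOpen_in
    exact hV ▸ inter_subset_left
  have hbd : ∀ x ∈ closure Ω, x ∉ Ω → ‖f x‖ ∈ Icc (Real.exp (-M)) (Real.exp M) := by
    intro x hx hxΩ
    apply norm_mem_Icc_of_abs_logAbs_le (by linarith)
    rw [hmM]
    exact (le_iSup₂ (f := fun x _ => (logAbs f x).abs) x
      (mem_boundaryIn hS.isClosed hΩS hx hxΩ)).trans (le_max_left _ _)
  obtain ⟨h0, hreg, hne₀⟩ := isRegularPoint_of_ddcEqDirac hf hdd hpar hz₀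
  have hzero : ∀ x ∈ Ω, f x = 0 → x = z₀ := fun x hx hx0 => by
    by_contra h
    exact apply_ne_zero_of_ddcEqDirac hf hdd hpar hx h hx0
  have hne : ∀ x ∈ Ω, ¬ ∀ᶠ y in 𝓝[Ω] x, f y = f x := fun x hx =>
    hf.not_eventually_eq hΩ.isConnected.isPreconnected hpar hz₀ hne₀ hx
  have hopen : ∀ x ∈ Ω, 𝓝 (f x) ≤ map f (𝓝[Ω] x) := fun x hx =>
    hf.nhds_le_map hpar hx (hne x hx)
  have hcomp : IsCompact (closure Ω) := hbdd.isCompact_closure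
  have hρbd : ∀ x ∈ closure Ω, x ∉ Ω → Real.exp (-M) ≤ ‖f x‖ := fun x hx h => (hbd x hx h).1
  have hsv : ball 0 (Real.exp (-M)) ⊆ simpleValues f Ω (Real.exp (-M)) :=
    ball_subset_simpleValues hcomp hfc hρbd hopen hf hpar hne
      ⟨mem_ball_self (Real.exp_pos _), z₀, hz₀, h0, hzero, hreg⟩
  have hdiff : DifferentiableOn ℂ (Function.invFunOn f Ω) (ball 0 (Real.exp (-M))) := fun w hw =>
    (differentiableAt_invFunOn hcomp hfc hρbd hopen hf (hsv hw)).differentiableWithinAt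
  rw [← hmM]
  exact normL1_logAbs_le hM1 hzero
    (fun x hx => norm_le_of_forall_boundary_le hcomp hfc hopen (fun y hy h => (hbd y hy h).2) hx)
    (areaMeasure_sublevel_le (Real.exp_pos _) hdiff hsv)
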